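/- Let $R$ be a commutative ring with unit and let $A$ be a cellular algebra over $R$ with cell datum $(\Lambda, M, C, *)$ in the sense of Graham and Lehrer. That is: $A$ is an associative unital $R$-algebra; $\Lambda$ is a poset; $M(\lambda)$ is a finite set for each $\lambda\in\Lambda$; the elements $C^\lambda_{S,T}$ ($\lambda\in\Lambda$, $S,T\in M(\lambda)$) form an $R$-basis of $A$; $*$ is an $R$-linear anti-involution of $A$ with $(C^\lambda_{S,T})^*=C^\lambda_{T,S}$; and for all $a\in A$, $\lambda\in\Lambda$ and $S,T\in M(\lambda)$ $$a\,C^\lambda_{S,T}\equiv\sum_{S'\in M(\lambda)} r_a(S',S)\,C^\lambda_{S',T} \pmod{A(<\lambda)},$$ where $r_a(S',S)\in R$ does not depend on $T$ and $A(<\lambda)$ is the $R$-span of all $C^\mu_{U,V}$ with $\mu<\lambda$. For $\lambda\in\Lambda$ let $W(\lambda)$ be the cell module, which as an $R$-module is free on symbols $C_q$, $q\in M(\lambda)$, and let $\phi_\lambda$ be the bilinear form on $W(\lambda)$ for which $\phi_\lambda(C_q,C_p)$ is the coefficient of $C^\lambda_{p_1,q_2}$ in the product $C^\lambda_{p_1,q}C^\lambda_{p,q_2}$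 (this does not depend on $p_1,q_2\in M(\lambda)$). For a downward closed subset $X\subseteq\Lambda$ let $I_X$ be the two-sided ideal of $A$ spanned over $R$ by the $C^\lambda_{S,T}$ with $\lambda\in X$, $S,T\in M(\lambda)$. Let $Y\subseteq X$ be downward closed subsets of $\Lambda$ with $X\setminus Y$ finite. Suppose that for every $\lambda\in X\setminus Y$ and every $q\in M(\lambda)$ there is $v\in W(\lambda)$ with $\phi_\lambda(C_q,v)=1$. Then, for every right $A$-module $M$ and every left $A$-module $N$ on both of which $I_X$ acts trivially, the quotient map $A/I_Y\to A/I_X$ induces an isomorphism of $R$-modules $$\mathrm{Tor}_n^{A/I_Y}(M,N)\;\cong\;\mathrm{Tor}_n^{A/I_X}(M,N)\qquad\text{for all } n\ge 0.$$ -/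

import Mathlib

open CategoryTheory MulOpposite
open scoped TensorProduct

universe uR uA uL uT uB uB' uM uM' w

/-! ### Cellular algebras -/

/-- The `R`-span of the elements `C l S T` with `l ∈ X`, for a family `C` of elements of `A`
indexed by pairs `S, T ∈ M l`. -/
def cellSpan (R : Type uR) {A : Type uA} [CommRing R] [Ring A] [Algebra R A]
    {L : Type uL} {M : L → Type uT} (C : (Σ l, M l × M l) → A) (X : Set L) : Submodule R A :=
  Submodule.span R {x | ∃ l ∈ X, ∃ S T : M l, x = C ⟨l, S, T⟩}

/-- A cell datum `(Λ, M, C, *)` for an associative unital `R`-algebra `A`, where `Λ` is the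
poset `L`.  Together with it, `A` is a cellular algebra in the sense of Graham and Lehrer. -/
structure CellDatum (R : Type uR) (A : Type uA) [CommRing R] [Ring A] [Algebra R A]
    (L : Type uL) [PartialOrder L] where
  /-- the finite set of tableaux of type `l` -/
  M : L → Type uT
  [fintypeM : ∀ l, Fintype (M l)]
  /-- the basis elements `C_{S,T}^l` -/
  C : Module.Basis (Σ l, M l × M l) R A
  /-- the `R`-linear anti-involution `*` -/
  star : A →ₗ[R] A
  star_star : ∀ a, star (star a) = a
  star_mul : ∀ a b, star (a * b) = star b * star a
  star_C : ∀ (l : L) (S T : M l), star (C ⟨l, S, T⟩) = C ⟨l, T, S⟩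
  /-- `a C_{S,T} ≡ ∑_{S'} r_a(S', S) C_{S',T}` modulo `A(< l)`, with `r_a(S', S)` independent
  of `T`. -/
  mul_C : ∀ l : L, ∃ r : A → M l → M l → R, ∀ (a : A) (S T : M l),
    a * C ⟨l, S, T⟩ - ∑ S' : M l, r a S' S • C ⟨l, S', T⟩ ∈ cellSpan R C {k | k < l}

namespace CellDatum

attribute [instance] CellDatum.fintypeM

variable {R : Type uR} {A : Type uA} [CommRing R] [Ring A] [Algebra R A]
  {L : Type uL} [PartialOrder L] (D : CellDatum.{uR, uA, uL, uT} R A L)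

/-- The underlying `R`-module of the cell module `W(l)`: the free `R`-module on the symbols `C_q`,
`q ∈ M(l)`. -/
abbrev W (l : L) : Type max uR uT := D.M l →₀ R

/-- The basis vector `C_q` of `W(l)`. -/
noncomputable abbrev basisW {l : L} (q : D.M l) : D.W l := Finsupp.single q 1

/-- The value `φ_l(C_q, C_p)`: the coefficient of `C_{p₁,q₂}` in `C_{p₁,q} C_{p,q₂}`. It does not
depend on `p₁` and `q₂` (see `gram_eq`), and the definition takes `p₁ = q`, `q₂ = p`. -/
noncomputable def gram {l : L} (q p : D.M l) : R :=
  D.C.repr (D.C ⟨l, q, q⟩ * D.C ⟨l, p, p⟩) ⟨l, q, p⟩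

/-- The bilinear form `φ_l` on the cell module `W(l)`. -/
noncomputable def form (l : L) : D.W l →ₗ[R] D.W l →ₗ[R] R :=
  Finsupp.linearCombination R fun q => Finsupp.linearCombination R fun p => D.gram q p

theorem form_basisW {l : L} (q p : D.M l) : D.form l (D.basisW q) (D.basisW p) = D.gram q p := by
  simp [form, basisW]

theorem repr_eq_zero {X : Set L} {a : A} (ha : a ∈ cellSpan R D.C X) {l : L} (hl : l ∉ X)
    (S T : D.M l) : D.C.repr a ⟨l, S, T⟩ = 0 := by
  classical
  refine Submodule.span_induction ?_ ?_ ?_ ?_ ha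
  · rintro x ⟨k, hk, U, V, rfl⟩
    rw [Module.Basis.repr_self, Finsupp.single_apply, if_neg]
    intro h
    cases h
    exact hl hk
  · simp
  · intro x y _ _ hx hy
    simp [hx, hy]
  · intro r x _ hx
    simp [hx]

theorem repr_mul_C {l : L} (r : A → D.M l → D.M l → R)
    (hr : ∀ (a : A) (S T : D.M l), a * D.C ⟨l, S, T⟩ - ∑ S' : D.M l, r a S' S • D.C ⟨l, S', T⟩ ∈
      cellSpan R D.C {k | k < l}) (a : A) (S S' T : D.M l) :
    D.C.repr (a * D.C ⟨l, S, T⟩) ⟨l, S', T⟩ = r a S' S := by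
  classical
  have h := D.repr_eq_zero (hr a S T) (lt_irrefl l) S' T
  rw [map_sub, Finsupp.sub_apply, sub_eq_zero] at h
  rw [h]
  simp [Finsupp.finsetSum_apply, Finsupp.single_apply]

theorem repr_star (a : A) {l : L} (S T : D.M l) :
    D.C.repr (D.star a) ⟨l, S, T⟩ = D.C.repr a ⟨l, T, S⟩ := by
  classical
  have : (Finsupp.lapply ⟨l, S, T⟩ ∘ₗ D.C.repr.toLinearMap) ∘ₗ D.star
      = Finsupp.lapply ⟨l, T, S⟩ ∘ₗ D.C.repr.toLinearMap := by
    refine D.C.ext ?_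
    rintro ⟨k, U, V⟩
    simp only [LinearMap.comp_apply, D.star_C, LinearEquiv.coe_coe, Module.Basis.repr_self,
      Finsupp.lapply_apply, Finsupp.single_apply]
    congr 1
    apply propext
    constructor
    · intro h
      cases h
      rfl
    · intro h
      cases h
      rfl
  exact LinearMap.congr_fun this a

/-- `φ_l(C_q, C_p)` is the coefficient of `C_{p₁,q₂}` in `C_{p₁,q} C_{p,q₂}`, for all `p₁, q₂`. -/
theorem gram_eq {l : L} (q p p₁ q₂ : D.M l) :
    D.C.repr (D.C ⟨l, p₁, q⟩ * D.C ⟨l, p, q₂⟩) ⟨l, p₁, q₂⟩ = D.gram q p := by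
  obtain ⟨r, hr⟩ := D.mul_C l
  have key : ∀ s t : D.M l, D.C.repr (D.C ⟨l, s, q⟩ * D.C ⟨l, p, t⟩) ⟨l, s, t⟩ =
      r (D.C ⟨l, s, q⟩) s p := fun s t => D.repr_mul_C r hr _ _ _ _
  have key' : ∀ s t : D.M l, D.C.repr (D.C ⟨l, s, q⟩ * D.C ⟨l, p, t⟩) ⟨l, s, t⟩ =
      r (D.C ⟨l, t, p⟩) t q := by
    intro s t
    rw [← D.repr_star, D.star_mul, D.star_C, D.star_C]
    exact D.repr_mul_C r hr _ _ _ _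
  rw [gram, key, ← key p₁ p, key', key']

theorem mem_cellSpan_of_lt {X : LowerSet L} {l : L} (hl : l ∈ X) :
    cellSpan R D.C {k | k < l} ≤ cellSpan R D.C (X : Set L) := by
  refine Submodule.span_mono ?_
  rintro x ⟨k, hk, S, T, rfl⟩
  exact ⟨k, X.lower (le_of_lt hk) hl, S, T, rfl⟩

theorem mul_mem_cellSpan (X : LowerSet L) (a : A) {x : A} (hx : x ∈ cellSpan R D.C (X : Set L)) :
    a * x ∈ cellSpan R D.C (X : Set L) := by
  refine Submodule.span_induction ?_ ?_ ?_ ?_ hx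
  · rintro x ⟨l, hl, S, T, rfl⟩
    obtain ⟨r, hr⟩ := D.mul_C l
    rw [← sub_add_cancel (a * D.C ⟨l, S, T⟩) (∑ S' : D.M l, r a S' S • D.C ⟨l, S', T⟩)]
    refine Submodule.add_mem _ (D.mem_cellSpan_of_lt hl (hr a S T)) ?_
    exact Submodule.sum_mem _ fun S' _ =>
      Submodule.smul_mem _ _ (Submodule.subset_span ⟨l, hl, S', T, rfl⟩)
  · simp
  · intro x y _ _ hx hy
    rw [mul_add]
    exact Submodule.add_mem _ hx hy
  · intro r x _ hx
    rw [mul_smul_comm]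
    exact Submodule.smul_mem _ _ hx

theorem star_mem_cellSpan (X : Set L) {x : A} (hx : x ∈ cellSpan R D.C X) :
    D.star x ∈ cellSpan R D.C X := by
  refine Submodule.span_induction ?_ ?_ ?_ ?_ hx
  · rintro x ⟨l, hl, S, T, rfl⟩
    rw [D.star_C]
    exact Submodule.subset_span ⟨l, hl, T, S, rfl⟩
  · simp
  · intro x y _ _ hx hy
    rw [map_add]
    exact Submodule.add_mem _ hx hy
  · intro r x _ hx
    rw [map_smul]
    exact Submodule.smul_mem _ _ hx

/-- The ideal `I_X`, for a downward closed subset `X` of the poset: the `R`-span of the `C_{S,T}^l`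
with `l ∈ X`. -/
def ideal (X : LowerSet L) : Ideal A where
  carrier := {a | a ∈ cellSpan R D.C (X : Set L)}
  add_mem' := fun ha hb => Submodule.add_mem (cellSpan R D.C (X : Set L)) ha hb
  zero_mem' := Submodule.zero_mem (cellSpan R D.C (X : Set L))
  smul_mem' := fun a _ hx => D.mul_mem_cellSpan X a hx

instance (X : LowerSet L) : (D.ideal X).IsTwoSided where
  mul_mem_of_left := by
    intro a b ha
    have h := D.star_mem_cellSpan _
      (D.mul_mem_cellSpan X (D.star b) (D.star_mem_cellSpan _ ha))
    rw [D.star_mul, D.star_star, D.star_star] at h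
    exact h

theorem ideal_mono {X Y : LowerSet L} (h : Y ≤ X) : D.ideal Y ≤ D.ideal X := by
  intro a ha
  refine Submodule.span_mono ?_ ha
  rintro x ⟨l, hl, S, T, rfl⟩
  exact ⟨l, h hl, S, T, rfl⟩

end CellDatum

/-! ### Modules over a quotient ring -/

section QuotientModules

variable {A : Type uA} [Ring A] (I : Ideal A) [I.IsTwoSided]

/-- A left `A`-module `N` on which `I` acts trivially, as a left module over `A ⧸ I`
(see `LeftQuot.mk_smul`). -/
@[nolint unusedArguments]
def LeftQuot (N : Type w) [AddCommGroup N] [Module A N]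
    (_hN : ∀ a ∈ I, ∀ x : N, a • x = 0) : Type w := N

/-- A right `A`-module `M` on which `I` acts trivially, as a right module over `A ⧸ I`
(see `RightQuot.mk_smul`). -/
@[nolint unusedArguments]
def RightQuot (M : Type uM) [AddCommGroup M] [Module Aᵐᵒᵖ M]
    (_hM : ∀ a ∈ I, ∀ m : M, op a • m = 0) : Type uM := M

variable {N : Type w} [AddCommGroup N] [Module A N] (hN : ∀ a ∈ I, ∀ x : N, a • x = 0)
variable {M : Type uM} [AddCommGroup M] [Module Aᵐᵒᵖ M] (hM : ∀ a ∈ I, ∀ m : M, op a • m = 0)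

instance : AddCommGroup (LeftQuot I N hN) := inferInstanceAs (AddCommGroup N)

noncomputable instance : Module (A ⧸ I) (LeftQuot I N hN) :=
  Module.compHom N
    (Ideal.Quotient.lift I (Module.toAddMonoidEnd A N) fun a ha => AddMonoidHom.ext (hN a ha))

theorem LeftQuot.mk_smul (a : A) (x : N) :
    (Ideal.Quotient.mk I a • (show LeftQuot I N hN from x) : LeftQuot I N hN) =
      (show LeftQuot I N hN from a • x) := rfl

instance : AddCommGroup (RightQuot I M hM) := inferInstanceAs (AddCommGroup M)

instance {R : Type uR} [CommRing R] [Module R M] : Module R (RightQuot I M hM) :=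
  inferInstanceAs (Module R M)

noncomputable instance : Module (A ⧸ I)ᵐᵒᵖ (RightQuot I M hM) :=
  Module.compHom M
    ((RingEquiv.opOp (AddMonoid.End M)).symm.toRingHom.comp (RingHom.op
      (Ideal.Quotient.lift I
        ((RingHom.op (Module.toAddMonoidEnd Aᵐᵒᵖ M)).comp (RingEquiv.opOp A).toRingHom)
        fun a ha => congrArg op (AddMonoidHom.ext (hM a ha)))))

theorem RightQuot.mk_smul (a : A) (m : M) :
    (op (Ideal.Quotient.mk I a) • (show RightQuot I M hM from m) : RightQuot I M hM) =
      (show RightQuot I M hM from op a • m) := rfl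

instance {R : Type uR} [CommRing R] [Algebra R A] [Module R M] [IsScalarTower R Aᵐᵒᵖ M] :
    IsScalarTower R (A ⧸ I)ᵐᵒᵖ (RightQuot I M hM) where
  smul_assoc r b m := by
    obtain ⟨a, ha⟩ := Ideal.Quotient.mk_surjective b.unop
    obtain rfl : op (Ideal.Quotient.mk I a) = b := by rw [ha, op_unop]
    exact smul_assoc r (op a) (show M from m)

end QuotientModules

/-! ### Tensor products and Tor over a noncommutative algebra -/

section BalancedTensor

variable (R : Type uR) [CommRing R] (B : Type uB) [Ring B]
  (M : Type uM) [AddCommGroup M] [Module R M] [Module Bᵐᵒᵖ M]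
  (N : Type w) [AddCommGroup N] [Module R N] [Module B N]

/-- The `R`-submodule of `M ⊗[R] N` spanned by the elements `m b ⊗ n - m ⊗ b n`. -/
def balancedRel : Submodule R (M ⊗[R] N) :=
  Submodule.span R {x | ∃ (m : M) (b : B) (n : N), x = (op b • m) ⊗ₜ[R] n - m ⊗ₜ[R] (b • n)}

/-- The tensor product `M ⊗_B N` of a right module `M` and a left module `N` over an
`R`-algebra `B`, as an `R`-module. -/
abbrev BalTensor : Type max uM w := (M ⊗[R] N) ⧸ balancedRel R B M N

variable {R B M N}
variable {B' : Type uB'} [Ring B']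
  {M' : Type uM'} [AddCommGroup M'] [Module R M'] [Module B'ᵐᵒᵖ M']
  {N' : Type w} [AddCommGroup N'] [Module R N'] [Module B' N']

/-- The map `M ⊗_B N → M' ⊗_{B'} N'` induced by maps `M → M'` and `N → N'` which are semilinear
with respect to a ring homomorphism `B → B'`. -/
def balMap (φ : B →+* B') (μ : M →ₗ[R] M') (hμ : ∀ (b : B) (m : M), μ (op b • m) = op (φ b) • μ m)
    (ν : N →ₗ[R] N') (hν : ∀ (b : B) (n : N), ν (b • n) = φ b • ν n) :
    BalTensor R B M N →ₗ[R] BalTensor R B' M' N' :=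
  Submodule.mapQ _ _ (TensorProduct.map μ ν) <| by
    refine Submodule.span_le.2 ?_
    rintro x ⟨m, b, n, rfl⟩
    refine Submodule.subset_span ⟨μ m, φ b, ν n, ?_⟩
    rw [map_sub, TensorProduct.map_tmul, TensorProduct.map_tmul, hμ, hν]

theorem balMap_mk_tmul (φ : B →+* B') (μ : M →ₗ[R] M')
    (hμ : ∀ (b : B) (m : M), μ (op b • m) = op (φ b) • μ m)
    (ν : N →ₗ[R] N') (hν : ∀ (b : B) (n : N), ν (b • n) = φ b • ν n) (m : M) (n : N) :
    balMap φ μ hμ ν hν (Submodule.Quotient.mk (m ⊗ₜ n)) = Submodule.Quotient.mk (μ m ⊗ₜ ν n) := rfl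

theorem balTensor_hom_ext {P : Type*} [AddCommGroup P] [Module R P]
    {f g : BalTensor R B M N →ₗ[R] P}
    (h : ∀ m n, f (Submodule.Quotient.mk (m ⊗ₜ n)) = g (Submodule.Quotient.mk (m ⊗ₜ n))) :
    f = g :=
  Submodule.linearMap_qext _ (TensorProduct.ext' h)

end BalancedTensor

section Lifts

variable {B : Type uB} [Ring B] {B' : Type uB'} [Ring B'] (φ : B →+* B')
  {N : ModuleCat.{w} B} {N' : ModuleCat.{w} B'}

theorem restrict_exact (S : ShortComplex (ModuleCat.{w} B')) (hS : S.Exact) :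
   (S.map (ModuleCat.restrictScalars.{w} φ)).Exact := by
  rw [ShortComplex.ShortExact.moduleCat_exact_iff_function_exact] at hS ⊢
  exact hS

/-- A morphism of `B`-modules from `N` to a `B'`-module `N'` lifts to projective resolutions. -/
theorem exists_lift_restrictScalars (ν : N ⟶ (ModuleCat.restrictScalars φ).obj N')
    (P : ProjectiveResolution N) (Q : ProjectiveResolution N') :
    ∃ (f : P.complex ⟶
      ((ModuleCat.restrictScalars φ).mapHomologicalComplex _).obj Q.complex),
    f.f 0 ≫ (ModuleCat.restrictScalars φ).map (Q.π.f 0) = P.π.f 0 ≫ ν := by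
  let F := (ModuleCat.restrictScalars.{w} φ)
  let K := (F.mapHomologicalComplex (ComplexShape.down ℕ)).obj Q.complex
  have hex : ∀ n, (ShortComplex.mk (K.d (n+2) (n+1)) (K.d (n+1) n) (K.d_comp_d _ _ _)).Exact := by
    intro n
    exact restrict_exact φ _ (Q.exact_succ n)
  have hex0 : (ShortComplex.mk (K.d 1 0) (F.map (Q.π.f 0)) (by
      change F.map _ ≫ F.map _ = 0
      rw [← F.map_comp, Q.complex_d_comp_π_f_zero]; exact F.map_zero _ _)).Exact := restrict_exact φ _ Q.exact₀
  let pi0 : K.X 0 ⟶ F.obj N' := F.map (Q.π.f 0)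
  have : Epi pi0 := by
    rw [ModuleCat.epi_iff_surjective]
    exact (ModuleCat.epi_iff_surjective (Q.π.f 0)).1 inferInstance
  let zero : P.complex.X 0 ⟶ K.X 0 := Projective.factorThru (P.π.f 0 ≫ ν) pi0
  have hz : zero ≫ pi0 = P.π.f 0 ≫ ν := Projective.factorThru_comp _ _
  let one : P.complex.X 1 ⟶ K.X 1 := hex0.liftFromProjective (P.complex.d 1 0 ≫ zero) (by
    change (P.complex.d 1 0 ≫ zero) ≫ pi0 = 0
    rw [Category.assoc, hz]
    exact (Category.assoc _ _ _).symm.trans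
      ((congrArg (· ≫ ν) P.complex_d_comp_π_f_zero).trans Limits.zero_comp))
  refine ⟨ChainComplex.mkHom _ K zero one (hex0.liftFromProjective_comp _ _) fun n p =>
    ⟨(hex n).liftFromProjective (P.complex.d (n+2) (n+1) ≫ p.2.1) ?_, (hex n).liftFromProjective_comp _ _⟩, ?_⟩
  · dsimp; rw [Category.assoc]; erw [p.2.2]; simp
  · exact hz

end Lifts

noncomputable section TorFunctor

variable (R : Type uR) [CommRing R]

/-- A module over an `R`-algebra `B`, as an `R`-module. -/
abbrev moduleOfAlgebra {B : Type uB} [Ring B] [Algebra R B] (N : ModuleCat.{w} B) : Module R N :=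
  Module.compHom N (algebraMap R B)

attribute [local instance] moduleOfAlgebra

/-- A morphism of modules over an `R`-algebra `B`, as an `R`-linear map. -/
def linearOfHom {B : Type uB} [Ring B] [Algebra R B] {N N' : ModuleCat.{w} B} (f : N ⟶ N') :
    N →ₗ[R] N' where
  toFun := f.hom
  map_add' := f.hom.map_add
  map_smul' r x := f.hom.map_smul (algebraMap R B r) x

/-- The functor `N ↦ M ⊗_B N` from left modules over an `R`-algebra `B` to `R`-modules, for a right
`B`-module `M`, on which `R` acts through `B`. -/
def tensorFunctor (B : Type uB) [Ring B] [Algebra R B]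
    (M : Type uM) [AddCommGroup M] [Module R M] [Module Bᵐᵒᵖ M] [IsScalarTower R Bᵐᵒᵖ M] :
    ModuleCat.{w} B ⥤ ModuleCat.{max uM w} R where
  obj N := ModuleCat.of R (BalTensor R B M N)
  map f := ModuleCat.ofHom <| balMap (RingHom.id B) LinearMap.id (fun _ _ => rfl)
    (linearOfHom R f) f.hom.map_smul
  map_id N := by
    ext : 1
    exact balTensor_hom_ext fun m n => rfl
  map_comp f g := by
    ext : 1
    exact balTensor_hom_ext fun m n => rfl

instance (B : Type uB) [Ring B] [Algebra R B]
    (M : Type uM) [AddCommGroup M] [Module R M] [Module Bᵐᵒᵖ M] [IsScalarTower R Bᵐᵒᵖ M] :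
    (tensorFunctor.{uR, uB, uM, w} R B M).Additive where
  map_add {N N' f g} := by
    ext : 1
    refine balTensor_hom_ext fun m n => ?_
    exact congrArg Submodule.Quotient.mk (TensorProduct.tmul_add m (f.hom n) (g.hom n))

/-- `Tor_n^B(M, N)`, for a right module `M` and a left module `N` over an `R`-algebra `B`: the
`n`-th left derived functor of `M ⊗_B -` at `N`, as an `R`-module. -/
def torObj (B : Type uB) [Ring B] [Algebra R B]
    (M : Type uM) [AddCommGroup M] [Module R M] [Module Bᵐᵒᵖ M] [IsScalarTower R Bᵐᵒᵖ M]
    (N : ModuleCat.{max uB w} B) (n : ℕ) : ModuleCat.{max uM uB w} R :=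
  ((tensorFunctor.{uR, uB, uM, max uB w} R B M).leftDerived n).obj N

variable {R}
variable {B : Type uB} [Ring B] [Algebra R B] {B' : Type uB} [Ring B'] [Algebra R B']
  (φ : B →ₐ[R] B')
  {M : Type uM} [AddCommGroup M] [Module R M] [Module Bᵐᵒᵖ M] [IsScalarTower R Bᵐᵒᵖ M]
  {M' : Type uM} [AddCommGroup M'] [Module R M'] [Module B'ᵐᵒᵖ M'] [IsScalarTower R B'ᵐᵒᵖ M']
  (μ : M →ₗ[R] M') (hμ : ∀ (b : B) (m : M), μ (op b • m) = op (φ b) • μ m)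

/-- The identity map of a `B'`-module `Q`, from `Q` regarded as a `B`-module along `φ`, as an
`R`-linear map. -/
def restrictLinear (Q : ModuleCat.{w} B') :
    ((ModuleCat.restrictScalars φ.toRingHom).obj Q) →ₗ[R] Q where
  toFun x := x
  map_add' _ _ := rfl
  map_smul' r x := by
    change φ (algebraMap R B r) • (show Q from x) = algebraMap R B' r • (show Q from x)
    rw [φ.commutes]

/-- The map `M ⊗_B Q → M' ⊗_{B'} Q`, `m ⊗ x ↦ μ m ⊗ x`, for a `B'`-module `Q` and a map
`μ : M → M'` which is semilinear with respect to `φ : B → B'`. -/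
def changeOfRings (Q : ModuleCat.{w} B') :
    (tensorFunctor R B M).obj ((ModuleCat.restrictScalars φ.toRingHom).obj Q) ⟶
      (tensorFunctor R B' M').obj Q :=
  ModuleCat.ofHom (balMap φ.toRingHom μ hμ (restrictLinear φ Q) fun _ _ => rfl)

/-- The chain map `M ⊗_B K → M' ⊗_{B'} K` for a complex `K` of `B'`-modules. -/
def changeOfRingsComplex (K : ChainComplex (ModuleCat.{w} B') ℕ) :
    ((tensorFunctor R B M).mapHomologicalComplex _).obj
        (((ModuleCat.restrictScalars φ.toRingHom).mapHomologicalComplex _).obj K) ⟶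
      ((tensorFunctor R B' M').mapHomologicalComplex _).obj K where
  f i := changeOfRings φ μ hμ (K.X i)
  comm' i j _ := by
    ext : 1
    exact balTensor_hom_ext fun m n => rfl

variable {N : ModuleCat.{max uB w} B} {N' : ModuleCat.{max uB w} B'}

/-- `t : Tor_n^B(M, N) → Tor_n^{B'}(M', N')` is the map induced by `φ : B → B'` and by the
`φ`-semilinear maps `μ : M → M'` and `ν : N → N'`: whenever `P → N` is a projective resolution over
`B`, `Q → N'` a projective resolution over `B'`, and `f : P → Q` a chain map of complexes of
`B`-modules lifting `ν`, the map `t` is the one induced on homology by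
`M ⊗_B P → M ⊗_B Q → M' ⊗_{B'} Q`. -/
def IsTorMap (ν : N ⟶ (ModuleCat.restrictScalars φ.toRingHom).obj N') (n : ℕ)
    (t : torObj.{uR, uB, uM, w} R B M N n ⟶ torObj.{uR, uB, uM, w} R B' M' N' n) : Prop :=
  ∀ (P : ProjectiveResolution N) (Q : ProjectiveResolution N')
    (f : P.complex ⟶
      ((ModuleCat.restrictScalars φ.toRingHom).mapHomologicalComplex _).obj Q.complex),
    f.f 0 ≫ (ModuleCat.restrictScalars φ.toRingHom).map (Q.π.f 0) = P.π.f 0 ≫ ν →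
    t ≫ (Q.isoLeftDerivedObj (tensorFunctor R B' M') n).hom =
      (P.isoLeftDerivedObj (tensorFunctor R B M) n).hom ≫
        HomologicalComplex.homologyMap
          (((tensorFunctor R B M).mapHomologicalComplex _).map f ≫
            changeOfRingsComplex φ μ hμ Q.complex) n

/-- There is at most one induced map on `Tor_n`. -/
theorem IsTorMap.unique {ν : N ⟶ (ModuleCat.restrictScalars φ.toRingHom).obj N'} {n : ℕ}
    {t t' : torObj.{uR, uB, uM, w} R B M N n ⟶ torObj.{uR, uB, uM, w} R B' M' N' n}
    (ht : IsTorMap φ μ hμ ν n t) (ht' : IsTorMap φ μ hμ ν n t') : t = t' := by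
  let P := projectiveResolution N
  let Q := projectiveResolution N'
  obtain ⟨f, hf⟩ := exists_lift_restrictScalars φ.toRingHom ν P Q
  exact (cancel_mono (Q.isoLeftDerivedObj (tensorFunctor R B' M') n).hom).1
    ((ht P Q f hf).trans (ht' P Q f hf).symm)

end TorFunctor

section QuotientMaps

variable {A : Type uA} [Ring A] {I J : Ideal A} [I.IsTwoSided] [J.IsTwoSided]

/-- For ideals `I ⊆ J` and a right `A`-module `M` on which both act trivially, the identity map
of `M`, from `M` as an `A ⧸ I`-module to `M` as an `A ⧸ J`-module. -/
def RightQuot.idMap (R : Type uR) [CommRing R] {M : Type uM} [AddCommGroup M] [Module R M]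
    [Module Aᵐᵒᵖ M] (hI : ∀ a ∈ I, ∀ m : M, op a • m = 0) (hJ : ∀ a ∈ J, ∀ m : M, op a • m = 0) :
    RightQuot I M hI →ₗ[R] RightQuot J M hJ :=
  (LinearMap.id : M →ₗ[R] M)

theorem RightQuot.idMap_smul {R : Type uR} [CommRing R] [Algebra R A] {M : Type uM} [AddCommGroup M]
    [Module R M] [Module Aᵐᵒᵖ M] (hI : ∀ a ∈ I, ∀ m : M, op a • m = 0)
    (hJ : ∀ a ∈ J, ∀ m : M, op a • m = 0) (h : I ≤ J) (b : A ⧸ I) (m : RightQuot I M hI) :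
    RightQuot.idMap R hI hJ (op b • m) =
      op (Ideal.Quotient.factorₐ R h b) • RightQuot.idMap R hI hJ m := by
  obtain ⟨a, rfl⟩ := Ideal.Quotient.mk_surjective b
  rfl

/-- For ideals `I ⊆ J` and a left `A`-module `N` on which both act trivially, the identity map
of `N`, from `N` as an `A ⧸ I`-module to `N` as an `A ⧸ J`-module. -/
noncomputable def LeftQuot.idMap (R : Type uR) [CommRing R] [Algebra R A] {N : Type w} [AddCommGroup N]
    [Module A N] (hI : ∀ a ∈ I, ∀ x : N, a • x = 0) (hJ : ∀ a ∈ J, ∀ x : N, a • x = 0)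
    (h : I ≤ J) :
    ModuleCat.of (A ⧸ I) (LeftQuot I N hI) ⟶
      (ModuleCat.restrictScalars (Ideal.Quotient.factorₐ R h).toRingHom).obj
        (ModuleCat.of (A ⧸ J) (LeftQuot J N hJ)) :=
  ModuleCat.ofHom (Y := (ModuleCat.restrictScalars (Ideal.Quotient.factorₐ R h).toRingHom).obj
      (ModuleCat.of (A ⧸ J) (LeftQuot J N hJ)))
    { toFun := fun x => x
      map_add' := fun _ _ => rfl
      map_smul' := fun b x => by
        obtain ⟨a, rfl⟩ := Ideal.Quotient.mk_surjective b
        rfl }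

end QuotientMaps

/-!
Write `B = A / I_Y` and `J = I_X / I_Y`, so that `A / I_X = B / J`. The theorem follows from one
statement: if `P → N` is a projective resolution over `B` and `J N = 0`, then `P / J P → N` is a
projective resolution over `B / J` (`CellDatum.exactModResolution`, `reductionResolution`). Indeed
`M J = 0` gives `M ⊗_B P = M ⊗_{B / J} P / J P` in each degree (`isIso_tensor_toReduction`), so both
`Tor`s are the homology of one and the same complex, and the comparison map lifts to the quotient
map `P → P / J P`. That this identifies the map induced on `Tor` for every choice of resolutions and
lifts is `isTorMap_of_resolutions`, which rests on the uniqueness of semilinear lifts up to homotopy.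

It remains to see that `P` stays exact modulo `J`. As `X \ Y` is finite, `X` is reached from `Y` by
adding one element `l` at a time, which enlarges the ideal `K` to an ideal `K'`, and exactness
modulo `K` has to be carried over to `K'`. The quotient `K' / K` has the basis `C_{p,T}`, with `p`
and `T` in `M(l)`, and is the direct sum of its rows, the right ideals spanned by the `C_{p,T}` with
fixed `p`. If `v = ∑ v_q C_q` satisfies `φ_l(C_p, v) = 1`, then `e_p = ∑ v_q C_{p,q}` acts on the row
of `p` as a left identity (`CellDatum.exists_rowIdempotents`). So `K' / K` is a direct sum of right
ideals generated by idempotents (`RowSplitting`), in particular projective as a right module.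

Independence of the rows passes to projective left modules (`RowSplitting.separates_of_projective`)
and holds trivially in `N`. A boundary `d x` lying in `K' P` therefore has row components which are
themselves cycles modulo `K`, hence boundaries `d z_p`, and the left identities show that they are
the boundaries of the elements `e_p z_p` of `K' P` (`RowSplitting.exactMod`).
-/

/-! ### Row splittings of ideals and exactness modulo an ideal -/

section RowSplittings

universe v

/-- A splitting, modulo `J`, of the ideal `J'` into a finite family of rows: the additive maps
`proj p` are right linear on `J'` and sum to the identity of `J'`, and the element `e p` of `J'` is
a left identity on row `p`, all of this modulo `J`. In the typical case `J' / J` is a finite direct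
sum of right ideals generated by idempotents `e p`, and the `proj p` are the projections; that they
are orthogonal is not required. The maps are defined on the whole of `B` only for convenience: no
condition is put on their values outside `J'`. -/
structure RowSplitting {B : Type uB} [Ring B] (J J' : Ideal B) (ι : Type uT) [Fintype ι] where
  proj : ι → B →+ B
  e : ι → B
  le : J ≤ J'
  proj_mem_left : ∀ p, ∀ j ∈ J, proj p j ∈ J
  proj_mem : ∀ p, ∀ j ∈ J', proj p j ∈ J'
  proj_mul : ∀ p, ∀ j ∈ J', ∀ b, proj p (j * b) - proj p j * b ∈ J
  sum_proj : ∀ j ∈ J', ∑ p, proj p j - j ∈ J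
  e_mem : ∀ p, e p ∈ J'
  e_mul_proj : ∀ p, ∀ j ∈ J', e p * proj p j - proj p j ∈ J

variable {B : Type uB} [Ring B]

/-- Elementwise form of the exactness of `P / J P → Q / J Q → T / J T` at the middle term, for
`P → Q → T`. That the composite is zero is not part of the condition. -/
def ExactMod (J : Ideal B) {P Q T : Type*} [AddCommGroup P] [AddCommGroup Q] [AddCommGroup T]
    [Module B P] [Module B Q] [Module B T] (f : P →ₗ[B] Q) (g : Q →ₗ[B] T) : Prop :=
  ∀ x, g x ∈ J • (⊤ : Submodule B T) → ∃ y, x - f y ∈ J • (⊤ : Submodule B Q)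

/-- An element of `J P` is a finite sum of products `j y` with `j ∈ J`; the summands are indexed by
distinct elements `y` of `P`. -/
theorem exists_sum_smul_of_mem_smul_top {J : Ideal B} {P : Type v} [AddCommGroup P] [Module B P]
    {x : P} (hx : x ∈ J • (⊤ : Submodule B P)) :
    ∃ (s : Finset P) (j : P → B), (∀ y, j y ∈ J) ∧ ∑ y ∈ s, j y • y = x := by
  suffices ∃ c : P →₀ B, (∀ y, c y ∈ J) ∧ c.sum (fun y b => b • y) = x by
    obtain ⟨c, hc, h⟩ := this
    exact ⟨c.support, c, hc, h⟩
  classical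
  refine Submodule.smul_induction_on hx ?_ ?_
  · intro b hb y _
    refine ⟨Finsupp.single y b, fun z => ?_, by simp⟩
    rw [Finsupp.single_apply]
    split_ifs
    · exact hb
    · exact J.zero_mem
  · rintro y z ⟨c, hc, rfl⟩ ⟨c', hc', rfl⟩
    refine ⟨c + c', fun t => J.add_mem (hc t) (hc' t), ?_⟩
    exact Finsupp.sum_add_index' (by simp) (fun _ _ _ => add_smul _ _ _)

theorem map_mem_smul_top {J : Ideal B} {P Q : Type*} [AddCommGroup P] [AddCommGroup Q]
    [Module B P] [Module B Q] (f : P →ₗ[B] Q) {x : P} (hx : x ∈ J • (⊤ : Submodule B P)) :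
    f x ∈ J • (⊤ : Submodule B Q) := by
  refine Submodule.smul_induction_on hx ?_ ?_
  · intro b hb y _
    rw [map_smul]
    exact Submodule.smul_mem_smul hb trivial
  · intro y z hy hz
    rw [map_add]
    exact Submodule.add_mem _ hy hz

theorem mem_of_mem_smul_top {J : Ideal B} [J.IsTwoSided] {x : B}
    (hx : x ∈ J • (⊤ : Submodule B B)) : x ∈ J := by
  refine Submodule.smul_induction_on hx ?_ ?_
  · intro b hb y _
    exact Ideal.mul_mem_right _ _ hb
  · intro y z hy hz
    exact J.add_mem hy hz

namespace RowSplitting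

variable {J J' : Ideal B} {ι : Type uT} [Fintype ι] (S : RowSplitting J J' ι)

/-- The rows of the splitting stay independent in `P`: a relation `∑ j y = 0` modulo `J P` with
coefficients in `J'` holds row by row. -/
def Separates (P : Type v) [AddCommGroup P] [Module B P] : Prop :=
  ∀ (κ : Type v) (s : Finset κ) (j : κ → B) (y : κ → P), (∀ k, j k ∈ J') →
    ∑ k ∈ s, j k • y k ∈ J • (⊤ : Submodule B P) →
      ∀ p, ∑ k ∈ s, S.proj p (j k) • y k ∈ J • (⊤ : Submodule B P)

theorem separates_of_smul_eq_zero {P : Type v} [AddCommGroup P] [Module B P]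
    (h : ∀ j ∈ J', ∀ x : P, j • x = 0) : S.Separates P := by
  intro κ s j y hj _ p
  rw [Finset.sum_eq_zero fun k _ => h _ (S.proj_mem p _ (hj k)) _]
  exact Submodule.zero_mem _

/-- In a projective module a relation can be tested on the coordinates of a dual basis, where it
becomes a relation in `B` to which right linearity of the row projections applies. -/
theorem separates_of_projective [J.IsTwoSided] (P : Type v) [AddCommGroup P] [Module B P]
    [Module.Projective B P] : S.Separates P := by
  intro κ s j y hj h p
  obtain ⟨c, hc⟩ := Module.projective_def'.1 ‹Module.Projective B P›
  have hc' (x : P) : Finsupp.linearCombination B id (c x) = x := LinearMap.congr_fun hc x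
  have key (z : P) : ∑ k ∈ s, S.proj p (j k) * c (y k) z ∈ J := by
    -- the relation on the coordinate of `z`
    have h1 : ∑ k ∈ s, j k * c (y k) z ∈ J := by
      refine mem_of_mem_smul_top ?_
      simpa [Finsupp.finsetSum_apply] using map_mem_smul_top (Finsupp.lapply z ∘ₗ c) h
    have h2 := S.proj_mem_left p _ h1
    rw [map_sum] at h2
    refine (Submodule.sub_mem_iff_right J h2).1 ?_
    rw [← Finset.sum_sub_distrib]
    exact J.sum_mem fun k _ => S.proj_mul p _ (hj k) _
  have : ∑ k ∈ s, S.proj p (j k) • y k =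
      Finsupp.linearCombination B id (∑ k ∈ s, S.proj p (j k) • c (y k)) := by
    rw [map_sum]
    exact Finset.sum_congr rfl fun k _ => by rw [map_smul, hc']
  rw [this, Finsupp.linearCombination_apply]
  refine Submodule.sum_mem _ fun z _ => Submodule.smul_mem_smul ?_ trivial
  simpa [Finsupp.finsetSum_apply] using key z

/-- Exactness modulo `J` at two consecutive places gives exactness modulo `J'`. If `d₂ x ∈ J' P₁`,
each row component `u` of `d₂ x` is a cycle modulo `J`, hence `u = d₂ z` modulo `J P₁`, and
`u = e u = d₂ (e z)`. Subtracting the elements `e z ∈ J' P₂` from `x` leaves a cycle modulo `J`. -/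
theorem exactMod {P₀ P₁ P₂ P₃ : Type v} [AddCommGroup P₀] [AddCommGroup P₁] [AddCommGroup P₂]
    [AddCommGroup P₃] [Module B P₀] [Module B P₁] [Module B P₂] [Module B P₃]
    {d₃ : P₃ →ₗ[B] P₂} {d₂ : P₂ →ₗ[B] P₁} {d₁ : P₁ →ₗ[B] P₀} (hd : ∀ x, d₁ (d₂ x) = 0)
    (h₀ : S.Separates P₀) (h₁ : ExactMod J d₂ d₁) (h₂ : ExactMod J d₃ d₂) :
    ExactMod J' d₃ d₂ := by
  intro x hx
  obtain ⟨s, j, hj, hs⟩ := exists_sum_smul_of_mem_smul_top hx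
  have hle (P : Type v) [AddCommGroup P] [Module B P] :
      J • (⊤ : Submodule B P) ≤ J' • (⊤ : Submodule B P) := Submodule.smul_mono_left S.le
  -- The row components of `d₂ x` are cycles modulo `J`.
  have hcycle (p : ι) : d₁ (∑ y ∈ s, S.proj p (j y) • y) ∈ J • (⊤ : Submodule B P₀) := by
    rw [map_sum]
    simp only [map_smul]
    refine h₀ P₁ s j d₁ hj ?_ p
    have : ∑ y ∈ s, j y • d₁ y = 0 := by
      rw [← hd x, ← hs, map_sum]
      simp only [map_smul]
    rw [this]
    exact Submodule.zero_mem _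
  choose z hz using fun p => h₁ _ (hcycle p)
  have hu (p : ι) : d₂ (S.e p • z p) - ∑ y ∈ s, S.proj p (j y) • y ∈
      J • (⊤ : Submodule B P₁) := by
    have h3 : S.e p • ∑ y ∈ s, S.proj p (j y) • y - ∑ y ∈ s, S.proj p (j y) • y ∈
        J • (⊤ : Submodule B P₁) := by
      rw [Finset.smul_sum, ← Finset.sum_sub_distrib]
      refine Submodule.sum_mem _ fun y _ => ?_
      rw [smul_smul, ← sub_smul]
      exact Submodule.smul_mem_smul (S.e_mul_proj p _ (hj y)) trivial
    have h4 := Submodule.sub_mem _ h3 (Submodule.smul_mem _ (S.e p) (hz p))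
    rw [smul_sub, map_smul] at *
    convert h4 using 1
    abel
  have hsum : ∑ p, ∑ y ∈ s, S.proj p (j y) • y - d₂ x ∈ J • (⊤ : Submodule B P₁) := by
    rw [← hs, Finset.sum_comm, ← Finset.sum_sub_distrib]
    refine Submodule.sum_mem _ fun y _ => ?_
    rw [← Finset.sum_smul, ← sub_smul]
    exact Submodule.smul_mem_smul (S.sum_proj _ (hj y)) trivial
  obtain ⟨y, hy⟩ := h₂ (x - ∑ p, S.e p • z p) (by
    have h5 := Submodule.add_mem _ (Submodule.sum_mem _ fun p (_ : p ∈ Finset.univ) => hu p) hsum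
    rw [← Submodule.neg_mem_iff]
    convert h5 using 1
    rw [map_sub, map_sum, Finset.sum_sub_distrib]
    abel)
  refine ⟨y, ?_⟩
  have h6 : ∑ p, S.e p • z p ∈ J' • (⊤ : Submodule B P₂) :=
    Submodule.sum_mem _ fun p _ => Submodule.smul_mem_smul (S.e_mem p) trivial
  convert Submodule.add_mem _ (hle _ hy) h6 using 1
  abel

/-- The image of a row splitting under a surjective ring homomorphism whose kernel is preserved by
the row projections. -/
noncomputable def map {C : Type uB'} [Ring C] {I₀ : Ideal B} {φ : B →+* C}
    (hφ : Function.Surjective φ) (hker : RingHom.ker φ = I₀) (hproj : ∀ p, ∀ b ∈ I₀, S.proj p b ∈ I₀) :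
    RowSplitting (J.map φ) (J'.map φ) ι :=
  let π (p : ι) : C →+ C := φ.toAddMonoidHom.liftOfSurjective hφ
    ⟨φ.toAddMonoidHom.comp (S.proj p), fun b hb => by
      subst hker
      exact hproj p b hb⟩
  have hπ (p : ι) (b : B) : π p (φ b) = φ (S.proj p b) :=
    φ.toAddMonoidHom.liftOfRightInverse_comp_apply _ (Function.rightInverse_surjInv hφ) _ b
  have hmem {K : Ideal B} {c : C} : c ∈ K.map φ ↔ ∃ b ∈ K, φ b = c :=
    Ideal.mem_map_iff_of_surjective φ hφ
  { proj := π
    e := fun p => φ (S.e p)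
    le := Ideal.map_mono S.le
    proj_mem_left := by
      rintro p _ hc
      obtain ⟨b, hb, rfl⟩ := hmem.1 hc
      rw [hπ]
      exact Ideal.mem_map_of_mem φ (S.proj_mem_left p b hb)
    proj_mem := by
      rintro p _ hc
      obtain ⟨b, hb, rfl⟩ := hmem.1 hc
      rw [hπ]
      exact Ideal.mem_map_of_mem φ (S.proj_mem p b hb)
    proj_mul := by
      rintro p _ hc c
      obtain ⟨b, hb, rfl⟩ := hmem.1 hc
      obtain ⟨a, rfl⟩ := hφ c
      rw [← map_mul, hπ, hπ, ← map_mul, ← map_sub]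
      exact Ideal.mem_map_of_mem φ (S.proj_mul p b hb a)
    sum_proj := by
      rintro _ hc
      obtain ⟨b, hb, rfl⟩ := hmem.1 hc
      simp only [hπ]
      rw [← map_sum, ← map_sub]
      exact Ideal.mem_map_of_mem φ (S.sum_proj b hb)
    e_mem := fun p => Ideal.mem_map_of_mem φ (S.e_mem p)
    e_mul_proj := by
      rintro p _ hc
      obtain ⟨b, hb, rfl⟩ := hmem.1 hc
      rw [hπ, ← map_mul, ← map_sub]
      exact Ideal.mem_map_of_mem φ (S.e_mul_proj p b hb) }

end RowSplitting

end RowSplittings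

/-! ### Row splittings in a cellular algebra -/

namespace CellDatum

variable {R : Type uR} {A : Type uA} [CommRing R] [Ring A] [Algebra R A]
  {L : Type uL} [PartialOrder L] (D : CellDatum.{uR, uA, uL, uT} R A L)

theorem gram_comm {l : L} (q p : D.M l) : D.gram q p = D.gram p q := by
  rw [gram, gram, ← D.repr_star, D.star_mul, D.star_C, D.star_C]

/-- The multiplication rule of a cell datum for right multiplication, obtained by applying `*`. -/
theorem exists_C_mul (l : L) : ∃ r : A → D.M l → D.M l → R, ∀ (a : A) (S T : D.M l),
    D.C ⟨l, S, T⟩ * a - ∑ T' : D.M l, r a T' T • D.C ⟨l, S, T'⟩ ∈ cellSpan R D.C {k | k < l} := by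
  obtain ⟨r, hr⟩ := D.mul_C l
  refine ⟨fun a => r (D.star a), fun a S T => ?_⟩
  have h := D.star_mem_cellSpan _ (hr (D.star a) T S)
  simpa only [map_sub, D.star_mul, D.star_star, D.star_C, map_sum, map_smul] using h

/-- `C_{p,q} C_{s,t} ≡ φ(C_q, C_s) C_{p,t}` modulo `A(< l)`. The left multiplication rule leaves only
the terms `C_{p',t}`, and the right one kills those with `p' ≠ p`. -/
theorem C_mul_C_sub_mem {l : L} (p q s t : D.M l) :
    D.C ⟨l, p, q⟩ * D.C ⟨l, s, t⟩ - D.gram q s • D.C ⟨l, p, t⟩ ∈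
      cellSpan R D.C {k | k < l} := by
  classical
  obtain ⟨r, hr⟩ := D.mul_C l
  obtain ⟨r', hr'⟩ := D.exists_C_mul l
  have h := hr (D.C ⟨l, p, q⟩) s t
  rw [Finset.sum_eq_single p, ← D.repr_mul_C r hr _ s p t, D.gram_eq] at h
  · exact h
  · intro p' _ hp'
    have h' := D.repr_eq_zero (hr' (D.C ⟨l, s, t⟩) p q) (lt_irrefl l) p' t
    rw [← D.repr_mul_C r hr _ s p' t]
    rw [map_sub, Finsupp.sub_apply, sub_eq_zero] at h'
    rw [h']
    simp [Finsupp.finsetSum_apply, hp'.symm]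
  · simp

open Classical in
/-- The `R`-linear projection of `A` onto the span of the row `C_{p,T}^l`, `T ∈ M(l)`, which kills
all the other basis elements. -/
noncomputable def rowProj {l : L} (p : D.M l) : A →ₗ[R] A :=
  D.C.constr R fun x => if (⟨x.1, x.2.1⟩ : Σ k, D.M k) = ⟨l, p⟩ then D.C x else 0

open Classical in
theorem rowProj_C {l : L} (p : D.M l) (x : Σ k, D.M k × D.M k) :
    D.rowProj p (D.C x) = if (⟨x.1, x.2.1⟩ : Σ k, D.M k) = ⟨l, p⟩ then D.C x else 0 :=
  D.C.constr_basis R _ x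

open Classical in
theorem rowProj_C_self {l : L} (p S T : D.M l) :
    D.rowProj p (D.C ⟨l, S, T⟩) = if S = p then D.C ⟨l, S, T⟩ else 0 := by
  simp [rowProj_C]

theorem rowProj_mem_cellSpan {l : L} (p : D.M l) {X : Set L} {a : A}
    (ha : a ∈ cellSpan R D.C X) : D.rowProj p a ∈ cellSpan R D.C X := by
  classical
  refine Submodule.span_le.2 (?_ : _ ⊆ ((cellSpan R D.C X).comap (D.rowProj p) : Set A)) ha
  rintro x ⟨k, hk, S, T, rfl⟩
  simp only [Submodule.comap_coe, Set.mem_preimage, rowProj_C, SetLike.mem_coe]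
  split_ifs
  · exact Submodule.subset_span ⟨k, hk, S, T, rfl⟩
  · exact Submodule.zero_mem _

theorem mem_ideal {X : LowerSet L} {a : A} : a ∈ D.ideal X ↔ a ∈ cellSpan R D.C (X : Set L) :=
  Iff.rfl

/-- A linear condition on `I_{Z'}`, where `Z'` is `Z` with `l` added, can be checked on the basis
elements `C_{S,T}^l` and on `I_Z`. -/
theorem map_mem_ideal_of_insert {l : L} {Z Z' : LowerSet L}
    (hZ' : (Z' : Set L) = insert l (Z : Set L)) (f : A →ₗ[R] A)
    (hC : ∀ S T : D.M l, f (D.C ⟨l, S, T⟩) ∈ D.ideal Z) (hZ : ∀ a ∈ D.ideal Z, f a ∈ D.ideal Z)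
    {a : A} (ha : a ∈ D.ideal Z') : f a ∈ D.ideal Z := by
  refine Submodule.span_le.2
    (?_ : _ ⊆ ((cellSpan R D.C (Z : Set L)).comap f : Set A)) (D.mem_ideal.1 ha)
  rintro x ⟨k, hk, S, T, rfl⟩
  rw [hZ'] at hk
  rcases hk with rfl | hk
  · exact hC S T
  · exact hZ _ (Submodule.subset_span ⟨k, hk, S, T, rfl⟩)

/-- If `φ_l(C_p, v) = 1`, then `e = ∑ v_q C_{p,q}` is a left identity on the row of `p`, modulo
`A(< l)`. The form is symmetric, so the side on which `v` occurs does not matter. -/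
theorem exists_rowIdempotents {l : L} (h : ∀ q : D.M l, ∃ v : D.W l, D.form l (D.basisW q) v = 1) :
    ∃ e : D.M l → A, (∀ p, e p ∈ cellSpan R D.C {l}) ∧
      ∀ p T, e p * D.C ⟨l, p, T⟩ - D.C ⟨l, p, T⟩ ∈ cellSpan R D.C {k | k < l} := by
  choose v hv using h
  refine ⟨fun p => ∑ q, v p q • D.C ⟨l, p, q⟩, fun p => ?_, fun p T => ?_⟩
  · exact Submodule.sum_mem _ fun q _ =>
      Submodule.smul_mem _ _ (Submodule.subset_span ⟨l, rfl, p, q, rfl⟩)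
  · have h1 : ∑ q, v p q * D.gram q p = 1 := by
      rw [← hv p]
      simp only [form, basisW, Finsupp.linearCombination_single, one_smul]
      rw [Finsupp.linearCombination_apply, Finsupp.sum_fintype _ _ (by simp)]
      exact Finset.sum_congr rfl fun q _ => by rw [D.gram_comm, smul_eq_mul]
    have h2 : (∑ q, v p q • D.C ⟨l, p, q⟩) * D.C ⟨l, p, T⟩ - D.C ⟨l, p, T⟩ =
        ∑ q, v p q • (D.C ⟨l, p, q⟩ * D.C ⟨l, p, T⟩ - D.gram q p • D.C ⟨l, p, T⟩) := by
      simp only [smul_sub, Finset.sum_sub_distrib, smul_smul]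
      rw [← Finset.sum_smul, h1, one_smul, Finset.sum_mul]
      simp only [smul_mul_assoc]
    rw [h2]
    exact Submodule.sum_mem _ fun q _ => Submodule.smul_mem _ _ (D.C_mul_C_sub_mem p q p T)

/-- Adding one element `l` to a lower set `Z` splits into the rows of `l`. The row projections
preserve every ideal `I_W`, so that they descend to all the quotients `A ⧸ I_W`. -/
theorem exists_rowSplitting {l : L} {Z Z' : LowerSet L} (hl : l ∉ Z)
    (hZ' : (Z' : Set L) = insert l (Z : Set L))
    (h : ∀ q : D.M l, ∃ v : D.W l, D.form l (D.basisW q) v = 1) :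
    ∃ S : RowSplitting (D.ideal Z) (D.ideal Z') (D.M l),
      ∀ (W : LowerSet L) (p), ∀ a ∈ D.ideal W, S.proj p a ∈ D.ideal W := by
  classical
  obtain ⟨e, he, hmul⟩ := D.exists_rowIdempotents h
  have hle : Z ≤ Z' := by
    intro k hk
    have : k ∈ (Z' : Set L) := by rw [hZ']; exact Or.inr hk
    exact this
  have hlZ' : l ∈ (Z' : Set L) := by rw [hZ']; exact Or.inl rfl
  have hlt : cellSpan R D.C {k | k < l} ≤ cellSpan R D.C (Z : Set L) := by
    refine Submodule.span_mono ?_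
    rintro x ⟨k, hk, S, T, rfl⟩
    refine ⟨k, ?_, S, T, rfl⟩
    have h3 : k ∈ (Z' : Set L) := Z'.lower (le_of_lt hk) hlZ'
    rw [hZ'] at h3
    exact h3.resolve_left (ne_of_lt hk)
  refine ⟨
    { proj := fun p => (D.rowProj p).toAddMonoidHom
      e := e
      le := D.ideal_mono hle
      proj_mem_left := fun p j hj => D.rowProj_mem_cellSpan p hj
      proj_mem := fun p j hj => D.rowProj_mem_cellSpan p hj
      proj_mul := fun p j hj b => ?_
      sum_proj := fun j hj => ?_
      e_mem := fun p => ?_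
      e_mul_proj := fun p j hj => ?_ }, fun W p a ha => D.rowProj_mem_cellSpan p ha⟩
  · refine D.map_mem_ideal_of_insert hZ'
      (D.rowProj p ∘ₗ LinearMap.mulRight R b - LinearMap.mulRight R b ∘ₗ D.rowProj p)
      (fun S T => ?_) (fun a ha => ?_) hj
    · obtain ⟨r, hr⟩ := D.exists_C_mul l
      have h1 := hlt (hr b S T)
      have h2 := D.rowProj_mem_cellSpan p h1
      simp only [map_sub, map_sum, map_smul, rowProj_C_self] at h2
      simp only [LinearMap.sub_apply, LinearMap.comp_apply, LinearMap.mulRight_apply,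
        rowProj_C_self]
      split_ifs at h2 ⊢ with hS
      · convert (D.ideal Z).sub_mem h2 h1 using 1
        abel
      · simp only [smul_zero, Finset.sum_const_zero, sub_zero] at h2
        simpa only [zero_mul, sub_zero] using D.mem_ideal.2 h2
    · exact (D.ideal Z).sub_mem (D.rowProj_mem_cellSpan p (Ideal.mul_mem_right _ _ ha))
        (Ideal.mul_mem_right _ _ (D.rowProj_mem_cellSpan p ha))
  · have := D.map_mem_ideal_of_insert hZ' (∑ p : D.M l, D.rowProj p - LinearMap.id)
      (fun S T => ?_) (fun a ha => ?_) hj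
    · simpa using this
    · simp [rowProj_C_self]
    · rw [LinearMap.sub_apply, LinearMap.sum_apply]
      exact (D.ideal Z).sub_mem (Ideal.sum_mem _ fun p _ => D.rowProj_mem_cellSpan p ha) ha
  · refine Submodule.span_mono ?_ (he p)
    rintro x ⟨k, rfl, S, T, rfl⟩
    exact ⟨k, hlZ', S, T, rfl⟩
  · refine D.map_mem_ideal_of_insert hZ'
      (LinearMap.mulLeft R (e p) ∘ₗ D.rowProj p - D.rowProj p)
      (fun S T => ?_) (fun a ha => ?_) hj
    · simp only [LinearMap.sub_apply, LinearMap.comp_apply, LinearMap.mulLeft_apply,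
        rowProj_C_self]
      split_ifs with hS
      · subst hS
        exact hlt (hmul S T)
      · simp
    · exact (D.ideal Z).sub_mem ((D.ideal Z).mul_mem_left _ (D.rowProj_mem_cellSpan p ha))
        (D.rowProj_mem_cellSpan p ha)

end CellDatum

section LowerSets

variable {L : Type uL} [PartialOrder L]

/-- A lower set `X` is reached from a lower set `Y ≤ X` with finite difference by adding one element
at a time: a minimal element of the difference can always be added first. -/
theorem LowerSet.reflTransGen_insert {X : LowerSet L} (Y : LowerSet L) (hYX : Y ≤ X)
    (hfin : ((X : Set L) \ (Y : Set L)).Finite) :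
    Relation.ReflTransGen (fun Z Z' : LowerSet L => ∃ l ∈ (X : Set L) \ (Y : Set L), l ∉ Z ∧
      (Z' : Set L) = insert l (Z : Set L)) Y X := by
  -- The induction changes `Y`, but the added elements have to lie in the original difference `U`.
  generalize hU : (X : Set L) \ (Y : Set L) = U
  have hsub : (X : Set L) \ (Y : Set L) ⊆ U := hU.le
  rw [hU] at hfin
  clear hU
  induction hn : ((X : Set L) \ (Y : Set L)).ncard using Nat.strong_induction_on generalizing Y with
  | _ n ih =>
  rcases ((X : Set L) \ (Y : Set L)).eq_empty_or_nonempty with h | h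
  · have : Y = X := le_antisymm hYX (Set.sdiff_eq_empty.1 h)
    rw [this]
  · have hfin' := hfin.subset hsub
    obtain ⟨l, hl⟩ := hfin'.exists_minimal h
    let Z : LowerSet L := ⟨insert l (Y : Set L), by
      rintro a b hba (rfl | ha)
      · by_cases hb : b ∈ Y
        · exact Or.inr hb
        · exact Or.inl (le_antisymm hba (hl.2 ⟨X.lower hba hl.1.1, hb⟩ hba))
      · exact Or.inr (Y.lower hba ha)⟩
    have hZX : Z ≤ X := by
      rintro a (rfl | ha)
      · exact hl.1.1
      · exact hYX ha
    have hss : (X : Set L) \ (Z : Set L) ⊆ (X : Set L) \ (Y : Set L) :=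
      fun a ha => ⟨ha.1, fun h => ha.2 (Or.inr h)⟩
    refine Relation.ReflTransGen.head ⟨l, hsub hl.1, hl.1.2, rfl⟩
      (ih _ ?_ Z hZX (hss.trans hsub) rfl)
    rw [← hn]
    exact Set.ncard_lt_ncard ⟨hss, fun h => (h hl.1).2 (Or.inl rfl)⟩ hfin'

end LowerSets

/-! ### Reduction of modules along a surjective ring homomorphism -/

section Reduction

universe v

variable {B : Type uB} [Ring B] {B' : Type uB'} [Ring B'] (φ : B →+* B')

/-- The module `P / (ker φ) P`, which is the extension of scalars `B' ⊗_B P` when `φ : B → B'` is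
surjective. -/
def Reduction (P : Type v) [AddCommGroup P] [Module B P] : Type v :=
  P ⧸ (RingHom.ker φ • (⊤ : Submodule B P))

namespace Reduction

variable {P : Type v} [AddCommGroup P] [Module B P]

instance : AddCommGroup (Reduction φ P) :=
  inferInstanceAs (AddCommGroup (P ⧸ (RingHom.ker φ • (⊤ : Submodule B P))))

/-- The quotient map `P → P / (ker φ) P`. -/
def mk : P →+ Reduction φ P :=
  (RingHom.ker φ • (⊤ : Submodule B P)).mkQ.toAddMonoidHom

theorem mk_surjective : Function.Surjective (mk φ (P := P)) :=
  Submodule.mkQ_surjective _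

theorem mk_eq_zero {x : P} : mk φ x = 0 ↔ x ∈ RingHom.ker φ • (⊤ : Submodule B P) :=
  Submodule.Quotient.mk_eq_zero _

/-- The additive map out of `P / (ker φ) P` induced by one which kills all `b x`, `b ∈ ker φ`. -/
def liftAddHom {T : Type*} [AddCommGroup T] (g : P →+ T)
    (hg : ∀ b ∈ RingHom.ker φ, ∀ x, g (b • x) = 0) : Reduction φ P →+ T :=
  QuotientAddGroup.lift (RingHom.ker φ • (⊤ : Submodule B P)).toAddSubgroup g fun _ hx =>
    Submodule.smul_induction_on hx (fun b hb x _ => hg b hb x)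
      fun _ _ hy hz => AddSubgroup.add_mem g.ker hy hz

theorem ker_le_ker_toAddMonoidEnd : RingHom.ker φ ≤
    RingHom.ker (Module.toAddMonoidEnd B (P ⧸ (RingHom.ker φ • (⊤ : Submodule B P)))) :=
  fun b hb => AddMonoidHom.ext fun x => by
    obtain ⟨x, rfl⟩ := Submodule.mkQ_surjective _ x
    exact (mk_eq_zero φ).2 (Submodule.smul_mem_smul hb trivial)

variable [RingHomSurjective φ]

/-- An element `φ b` of `B'` acts as `b`. -/
noncomputable instance : Module B' (Reduction φ P) :=
  Module.compHom (P ⧸ (RingHom.ker φ • (⊤ : Submodule B P)))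
    (φ.liftOfSurjective RingHomSurjective.is_surjective
      ⟨_, ker_le_ker_toAddMonoidEnd φ (P := P)⟩)

theorem smul_mk (b : B) (x : P) : φ b • mk φ x = mk φ (b • x) :=
  DFunLike.congr_fun (F := AddMonoid.End (P ⧸ (RingHom.ker φ • (⊤ : Submodule B P))))
    (φ.liftOfRightInverse_comp_apply _
      (Function.rightInverse_surjInv RingHomSurjective.is_surjective)
      ⟨_, ker_le_ker_toAddMonoidEnd φ (P := P)⟩ b) (Submodule.Quotient.mk x)

end Reduction

theorem smul_restrictScalars_eq_zero {b : B} (hb : b ∈ RingHom.ker φ) {Z : ModuleCat.{v} B'}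
    (z : (ModuleCat.restrictScalars φ).obj Z) : b • z = 0 := by
  change φ b • (show Z from z) = 0
  rw [RingHom.mem_ker.1 hb, zero_smul]

variable [RingHomSurjective φ]

/-- The quotient map `P → P / (ker φ) P`, as a map of `B`-modules. -/
noncomputable def toReduction (P : ModuleCat.{v} B) :
    P ⟶ (ModuleCat.restrictScalars φ).obj (ModuleCat.of B' (Reduction φ P)) :=
  ModuleCat.ofHom (Y := (ModuleCat.restrictScalars φ).obj (ModuleCat.of B' (Reduction φ P)))
    { toFun := Reduction.mk φ
      map_add' := map_add _
      map_smul' := fun b x => (Reduction.smul_mk φ b x).symm }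

/-- The map of `B'`-modules `P / (ker φ) P → Z` which corresponds to a map of `B`-modules `P → Z`. -/
noncomputable def reductionDesc {P : ModuleCat.{v} B} {Z : ModuleCat.{v} B'}
    (g : P ⟶ (ModuleCat.restrictScalars φ).obj Z) : ModuleCat.of B' (Reduction φ P) ⟶ Z :=
  let g' : Reduction φ P →+ Z := Reduction.liftAddHom φ g.hom.toAddMonoidHom fun b hb x =>
    (g.hom.map_smul b x).trans (smul_restrictScalars_eq_zero φ hb _)
  ModuleCat.ofHom
    { toFun := g'
      map_add' := g'.map_add
      map_smul' := fun b x => by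
        obtain ⟨b, rfl⟩ := RingHomSurjective.is_surjective (σ := φ) b
        obtain ⟨x, rfl⟩ := Reduction.mk_surjective φ x
        rw [Reduction.smul_mk]
        exact g.hom.map_smul b x }

theorem reduction_hom_ext {P : ModuleCat.{v} B} {Z : ModuleCat.{v} B'}
    {f g : ModuleCat.of B' (Reduction φ P) ⟶ Z}
    (h : ∀ x, f.hom (Reduction.mk φ x) = g.hom (Reduction.mk φ x)) : f = g := by
  ext x
  obtain ⟨x, rfl⟩ := Reduction.mk_surjective φ x
  exact h x

/-- The functor `P ↦ P / (ker φ) P` from `B`-modules to `B'`-modules. -/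
noncomputable def reductionFunctor : ModuleCat.{v} B ⥤ ModuleCat.{v} B' where
  obj P := ModuleCat.of B' (Reduction φ P)
  map {_ Q} f := reductionDesc φ (f ≫ toReduction φ Q)
  map_id _ := reduction_hom_ext φ fun _ => rfl
  map_comp _ _ := reduction_hom_ext φ fun _ => rfl

instance : (reductionFunctor.{uB, uB', v} φ).Additive where
  map_add {_ _ f g} := reduction_hom_ext φ fun x => (Reduction.mk φ).map_add (f.hom x) (g.hom x)

/-- Reduction is left adjoint to restriction of scalars, which preserves epimorphisms. -/
instance {P : ModuleCat.{v} B} [Projective P] : Projective ((reductionFunctor φ).obj P) where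
  factors {E Z} f e _ := by
    have : Epi ((ModuleCat.restrictScalars φ).map e) := by
      rw [ModuleCat.epi_iff_surjective]
      exact (ModuleCat.epi_iff_surjective e).1 inferInstance
    let f' : P ⟶ (ModuleCat.restrictScalars φ).obj Z :=
      toReduction φ P ≫ (ModuleCat.restrictScalars φ).map f
    refine ⟨reductionDesc φ (Projective.factorThru f' ((ModuleCat.restrictScalars φ).map e)),
      reduction_hom_ext φ fun x => ?_⟩
    exact LinearMap.congr_fun (congrArg ModuleCat.Hom.hom
      (Projective.factorThru_comp f' ((ModuleCat.restrictScalars φ).map e))) x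

theorem reduction_exact {P Q T : ModuleCat.{v} B} {f : P ⟶ Q} {g : Q ⟶ T} (w : f ≫ g = 0)
    (h : ExactMod (RingHom.ker φ) f.hom g.hom) :
    ((ShortComplex.mk f g w).map (reductionFunctor φ)).Exact := by
  rw [ShortComplex.moduleCat_exact_iff]
  intro x hx
  obtain ⟨x, rfl⟩ := Reduction.mk_surjective φ x
  obtain ⟨y, hy⟩ := h x ((Reduction.mk_eq_zero φ).1 hx)
  refine ⟨Reduction.mk φ y, ?_⟩
  have := (Reduction.mk_eq_zero φ).2 hy
  rw [map_sub, sub_eq_zero] at this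
  exact this.symm

section Resolution

variable {N : ModuleCat.{v} B} {N' : ModuleCat.{v} B'} (P : ProjectiveResolution N)
  (ν : N ⟶ (ModuleCat.restrictScalars φ).obj N')

theorem reduction_d_comp_desc :
    (reductionFunctor φ).map (P.complex.d 1 0) ≫ reductionDesc φ (P.π.f 0 ≫ ν) = 0 :=
  reduction_hom_ext φ fun x => by
    have : (P.π.f 0).hom ((P.complex.d 1 0).hom x) = 0 :=
      LinearMap.congr_fun (congrArg ModuleCat.Hom.hom P.complex_d_comp_π_f_zero) x
    exact (congrArg ν.hom this).trans (map_zero ν.hom)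

/-- If a projective resolution `P → N` over `B` stays exact modulo `ker φ`, then its reduction is a
projective resolution over `B'` of the module `N'` with the same underlying `B`-module as `N`. -/
noncomputable def reductionResolution (hν : Function.Bijective ν.hom)
    (h₀ : ExactMod (RingHom.ker φ) (P.complex.d 1 0).hom (P.π.f 0).hom)
    (h : ∀ n, ExactMod (RingHom.ker φ) (P.complex.d (n + 2) (n + 1)).hom
      (P.complex.d (n + 1) n).hom) : ProjectiveResolution N' where
  complex := ((reductionFunctor φ).mapHomologicalComplex _).obj P.complex
  projective n := inferInstanceAs (Projective ((reductionFunctor φ).obj (P.complex.X n)))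
  π := (ChainComplex.toSingle₀Equiv _ _).symm ⟨reductionDesc φ (P.π.f 0 ≫ ν),
    reduction_d_comp_desc φ P ν⟩
  quasiIso := by
    have hepi : Epi (reductionDesc φ (P.π.f 0 ≫ ν)) := by
      rw [ModuleCat.epi_iff_surjective]
      intro y
      obtain ⟨z, rfl⟩ := hν.2 y
      obtain ⟨x, rfl⟩ := (ModuleCat.epi_iff_surjective (P.π.f 0)).1 inferInstance z
      exact ⟨Reduction.mk φ x, rfl⟩
    have hex : (ShortComplex.mk ((reductionFunctor φ).map (P.complex.d 1 0))
        (reductionDesc φ (P.π.f 0 ≫ ν)) (reduction_d_comp_desc φ P ν)).Exact := by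
      rw [ShortComplex.moduleCat_exact_iff]
      intro x hx
      obtain ⟨x, rfl⟩ := Reduction.mk_surjective φ x
      have hx' : (P.π.f 0).hom x = 0 := hν.1 (hx.trans (map_zero ν.hom).symm)
      obtain ⟨y, hy⟩ := h₀ x (by rw [hx']; exact Submodule.zero_mem _)
      refine ⟨Reduction.mk φ y, ?_⟩
      have := (Reduction.mk_eq_zero φ).2 hy
      rw [map_sub, sub_eq_zero] at this
      exact this.symm
    refine ⟨fun n => ?_⟩
    cases n
    · rw [ChainComplex.quasiIsoAt₀_iff, ShortComplex.quasiIso_iff_of_zeros']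
      · refine (ShortComplex.exact_and_epi_g_iff_of_iso ?_).2 ⟨hex, hepi⟩
        exact ShortComplex.isoMk (Iso.refl _) (Iso.refl _) (Iso.refl _)
          ((Category.id_comp _).trans (Category.comp_id _).symm)
          ((Category.id_comp _).trans (Category.comp_id _).symm)
      · exact HomologicalComplex.shape
          (((reductionFunctor φ).mapHomologicalComplex _).obj P.complex) 0 0 (by simp)
      all_goals rfl
    · rw [quasiIsoAt_iff_exactAt']
      · rename_i n
        rw [HomologicalComplex.exactAt_iff' _ (n + 1 + 1) (n + 1) n (by simp) (by simp)]
        exact reduction_exact φ (P.complex.d_comp_d _ _ _) (h n)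
      · apply ChainComplex.exactAt_succ_single_obj

end Resolution

end Reduction

/-! ### Comparison maps on Tor -/

section HomotopyUniqueness

universe v u

variable {C : Type u} [Category.{v} C] [Abelian C]

/-- A chain map from a complex of projectives to an exact augmented complex is null-homotopic if it
vanishes after the augmentation. The terms of the target need not be projective. -/
theorem nonempty_homotopy_zero (P K : ChainComplex C ℕ) [∀ n, Projective (P.X n)] {Z : C}
    (p : K.X 0 ⟶ Z) (w : K.d 1 0 ≫ p = 0) (h₀ : (ShortComplex.mk _ _ w).Exact)
    (h : ∀ n, (ShortComplex.mk _ _ (K.d_comp_d (n + 2) (n + 1) n)).Exact)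
    (f : P ⟶ K) (hf : f.f 0 ≫ p = 0) : Nonempty (Homotopy f 0) := by
  let s₀ : P.X 0 ⟶ K.X 1 := h₀.liftFromProjective (f.f 0) hf
  have hs₀ : s₀ ≫ K.d 1 0 = f.f 0 := h₀.liftFromProjective_comp _ _
  have hz : (f.f 1 - P.d 1 0 ≫ s₀) ≫ K.d 1 0 = 0 := by
    rw [Preadditive.sub_comp, Category.assoc, hs₀, f.comm, sub_self]
  let s₁ : P.X 1 ⟶ K.X 2 := (h 0).liftFromProjective (f.f 1 - P.d 1 0 ≫ s₀) hz
  have hs₁ : s₁ ≫ K.d 2 1 = f.f 1 - P.d 1 0 ≫ s₀ := (h 0).liftFromProjective_comp _ _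
  have hk (n : ℕ) (s : P.X n ⟶ K.X (n + 1)) (s' : P.X (n + 1) ⟶ K.X (n + 2))
      (hs : f.f (n + 1) = P.d (n + 1) n ≫ s + s' ≫ K.d (n + 2) (n + 1)) :
      (f.f (n + 2) - P.d (n + 2) (n + 1) ≫ s') ≫ K.d (n + 2) (n + 1) = 0 := by
    rw [Preadditive.sub_comp, f.comm, hs, Preadditive.comp_add, P.d_comp_d_assoc,
      Limits.zero_comp, zero_add, Category.assoc, sub_self]
  exact ⟨Homotopy.mkInductive _ s₀ hs₀.symm s₁ (by rw [hs₁]; abel) fun n g =>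
    ⟨(h (n + 1)).liftFromProjective _ (hk n g.1 g.2.1 g.2.2), by
      have := (h (n + 1)).liftFromProjective_comp _ (hk n g.1 g.2.1 g.2.2)
      dsimp only at this ⊢
      rw [this]
      abel⟩⟩

end HomotopyUniqueness

section SemilinearHomotopy

variable {B : Type uB} [Ring B] {B' : Type uB'} [Ring B'] (φ : B →+* B')
  {N : ModuleCat.{w} B} {N' : ModuleCat.{w} B'}

/-- Two lifts of a map `N → N'`, semilinear along `φ : B → B'`, to projective resolutions over `B`
and over `B'` are homotopic. -/
theorem nonempty_homotopy_of_comp_π_eq (P : ProjectiveResolution N) (Q : ProjectiveResolution N')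
    (f g : P.complex ⟶
      ((ModuleCat.restrictScalars φ).mapHomologicalComplex _).obj Q.complex)
    (h : f.f 0 ≫ (ModuleCat.restrictScalars φ).map (Q.π.f 0) =
      g.f 0 ≫ (ModuleCat.restrictScalars φ).map (Q.π.f 0)) : Nonempty (Homotopy f g) := by
  have w : (ModuleCat.restrictScalars.{w} φ).map (Q.complex.d 1 0) ≫
      (ModuleCat.restrictScalars φ).map (Q.π.f 0) = 0 := by
    rw [← Functor.map_comp, Q.complex_d_comp_π_f_zero, Functor.map_zero]
  obtain ⟨H⟩ := nonempty_homotopy_zero P.complex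
    (((ModuleCat.restrictScalars φ).mapHomologicalComplex (ComplexShape.down ℕ)).obj Q.complex)
    ((ModuleCat.restrictScalars φ).map (Q.π.f 0)) w
    (restrict_exact φ _ Q.exact₀) (fun n => restrict_exact φ _ (Q.exact_succ n)) (f - g)
    ((Preadditive.sub_comp _ _ _).trans (sub_eq_zero.2 h))
  exact ⟨Homotopy.equivSubZero.symm H⟩

end SemilinearHomotopy

section Diagrams

universe v u

variable {C : Type u} [Category.{v} C]

theorem comp_eq_comp_of_factors {T T' X X₀ Y Y₀ : C} {t : T ⟶ T'} {p : T ⟶ X} {p₀ : T ⟶ X₀}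
    {q : T' ⟶ Y} {q₀ : T' ⟶ Y₀} {g₀ : X₀ ⟶ Y₀} {g : X ⟶ Y} {a : X ⟶ X₀} {b : Y₀ ⟶ Y}
    (h : t ≫ q₀ = p₀ ≫ g₀) (ha : p₀ = p ≫ a) (hb : q = q₀ ≫ b) (hg : g = a ≫ g₀ ≫ b) :
    t ≫ q = p ≫ g := by
  rw [hb, hg, reassoc_of% h, ha, Category.assoc]

theorem trans_trans_symm_hom_comp {X Y Z T : C} (i : X ≅ Y) (j : Y ≅ Z) (k : T ≅ Z) :
    (i ≪≫ j ≪≫ k.symm).hom ≫ k.hom = i.hom ≫ j.hom := by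
  simp

end Diagrams

section TorMaps

attribute [local instance] moduleOfAlgebra

variable {R : Type uR} [CommRing R]
variable {B : Type uB} [Ring B] [Algebra R B] {B' : Type uB} [Ring B'] [Algebra R B']
  (φ : B →ₐ[R] B')
  {M : Type uM} [AddCommGroup M] [Module R M] [Module Bᵐᵒᵖ M] [IsScalarTower R Bᵐᵒᵖ M]
  {M' : Type uM} [AddCommGroup M'] [Module R M'] [Module B'ᵐᵒᵖ M'] [IsScalarTower R B'ᵐᵒᵖ M']
  (μ : M →ₗ[R] M') (hμ : ∀ (b : B) (m : M), μ (op b • m) = op (φ b) • μ m)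

theorem changeOfRingsComplex_naturality {K K' : ChainComplex (ModuleCat.{w} B') ℕ} (b : K ⟶ K') :
    changeOfRingsComplex φ μ hμ K ≫ ((tensorFunctor R B' M').mapHomologicalComplex _).map b =
      ((tensorFunctor R B M).mapHomologicalComplex _).map
        (((ModuleCat.restrictScalars φ.toRingHom).mapHomologicalComplex _).map b) ≫
          changeOfRingsComplex φ μ hμ K' := by
  ext i : 2
  exact balTensor_hom_ext fun m n => rfl

section

variable {N : ModuleCat.{max uB w} B} {N' : ModuleCat.{max uB w} B'}

/-- The map on `Tor` induced by a semilinear map can be recognized on a single choice of projective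
resolutions and of a lift. -/
theorem isTorMap_of_resolutions {ν : N ⟶ (ModuleCat.restrictScalars φ.toRingHom).obj N'} {n : ℕ}
    {t : torObj.{uR, uB, uM, w} R B M N n ⟶ torObj.{uR, uB, uM, w} R B' M' N' n}
    (P₀ : ProjectiveResolution N) (Q₀ : ProjectiveResolution N')
    (f₀ : P₀.complex ⟶
      ((ModuleCat.restrictScalars φ.toRingHom).mapHomologicalComplex _).obj Q₀.complex)
    (hf₀ : f₀.f 0 ≫ (ModuleCat.restrictScalars φ.toRingHom).map (Q₀.π.f 0) = P₀.π.f 0 ≫ ν)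
    (h : t ≫ (Q₀.isoLeftDerivedObj (tensorFunctor R B' M') n).hom =
      (P₀.isoLeftDerivedObj (tensorFunctor R B M) n).hom ≫
        HomologicalComplex.homologyMap
          (((tensorFunctor R B M).mapHomologicalComplex _).map f₀ ≫
            changeOfRingsComplex φ μ hμ Q₀.complex) n) :
    IsTorMap φ μ hμ ν n t := by
  intro P Q f hf
  let a := ProjectiveResolution.lift (𝟙 N) P P₀
  let b := ProjectiveResolution.lift (𝟙 N') Q₀ Q
  have ha₀ : a.f 0 ≫ P₀.π.f 0 = P.π.f 0 ≫ 𝟙 N :=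
    ProjectiveResolution.lift_commutes_zero (𝟙 N) P P₀
  have hb₀ : b.f 0 ≫ Q.π.f 0 = Q₀.π.f 0 ≫ 𝟙 N' :=
    ProjectiveResolution.lift_commutes_zero (𝟙 N') Q₀ Q
  have ha := ProjectiveResolution.isoLeftDerivedObj_hom_naturality (𝟙 N) P P₀ a ha₀
    (tensorFunctor R B M) n
  have hb := ProjectiveResolution.isoLeftDerivedObj_hom_naturality (𝟙 N') Q₀ Q b hb₀
    (tensorFunctor R B' M') n
  rw [CategoryTheory.Functor.map_id, Category.id_comp] at ha hb
  obtain ⟨H⟩ := nonempty_homotopy_of_comp_π_eq φ.toRingHom P Q f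
    (a ≫ f₀ ≫ ((ModuleCat.restrictScalars φ.toRingHom).mapHomologicalComplex _).map b) (by
      ext x
      have e₁ := LinearMap.congr_fun (congrArg ModuleCat.Hom.hom hf) x
      have e₂ := LinearMap.congr_fun (congrArg ModuleCat.Hom.hom ha₀) x
      have e₃ := LinearMap.congr_fun (congrArg ModuleCat.Hom.hom hf₀) ((a.f 0).hom x)
      have e₄ := LinearMap.congr_fun (congrArg ModuleCat.Hom.hom hb₀)
        ((f₀.f 0).hom ((a.f 0).hom x))
      exact e₁.trans (e₄.trans (e₃.trans (congrArg ν.hom e₂))).symm)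
  have hH := ((tensorFunctor R B M).mapHomotopy H).homologyMap_eq n
  have hg : HomologicalComplex.homologyMap
        (((tensorFunctor R B M).mapHomologicalComplex _).map f ≫
          changeOfRingsComplex φ μ hμ Q.complex) n =
      HomologicalComplex.homologyMap (((tensorFunctor R B M).mapHomologicalComplex _).map a) n ≫
        HomologicalComplex.homologyMap
          (((tensorFunctor R B M).mapHomologicalComplex _).map f₀ ≫
            changeOfRingsComplex φ μ hμ Q₀.complex) n ≫
          HomologicalComplex.homologyMap
            (((tensorFunctor R B' M').mapHomologicalComplex _).map b) n := by
    rw [HomologicalComplex.homologyMap_comp, hH, ← HomologicalComplex.homologyMap_comp,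
      ← HomologicalComplex.homologyMap_comp, ← HomologicalComplex.homologyMap_comp,
      Category.assoc, changeOfRingsComplex_naturality, Functor.map_comp, Functor.map_comp,
      Category.assoc, Category.assoc]
  exact comp_eq_comp_of_factors h ha hb hg

end

section

variable [RingHomSurjective φ.toRingHom]

/-- The map `M' ⊗_{B'} P / (ker φ) P → M ⊗_B P`, `μ m ⊗ [x] ↦ m ⊗ x`, for bijective `μ`. It is well
defined because `m ⊗ b x = m b ⊗ x = 0` for `b ∈ ker φ`. -/
noncomputable def tensorReductionInv (hinj : Function.Injective μ) (hsurj : Function.Surjective μ)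
    (P : ModuleCat.{w} B) :
    (tensorFunctor R B' M').obj ((reductionFunctor φ.toRingHom).obj P) ⟶
      (tensorFunctor R B M).obj P :=
  let e : M ≃ₗ[R] M' := LinearEquiv.ofBijective μ ⟨hinj, hsurj⟩
  let q : M →ₗ[R] P →ₗ[R] BalTensor R B M P :=
    (TensorProduct.mk R M P).compr₂ (balancedRel R B M P).mkQ
  have hq (b : B) (m : M) (x : P) : q m (b • x) = q (op b • m) x := by
    have h : (op b • m) ⊗ₜ[R] x - m ⊗ₜ[R] (b • x) ∈ balancedRel R B M P :=
      Submodule.subset_span ⟨m, b, x, rfl⟩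
    exact ((Submodule.Quotient.eq _).2 h).symm
  have hker (m : M) (b : B) (hb : b ∈ RingHom.ker φ.toRingHom) (x : P) : q m (b • x) = 0 := by
    have : op b • m = 0 := hinj (by
      rw [hμ, map_zero, show φ b = 0 from hb, op_zero, zero_smul])
    rw [hq, this, map_zero, LinearMap.zero_apply]
  let g (m : M) : Reduction φ.toRingHom P →+ BalTensor R B M P :=
    Reduction.liftAddHom φ.toRingHom (q m).toAddMonoidHom (hker m)
  have hg (m : M) (x : P) : g m (Reduction.mk _ x) = q m x := rfl
  let G : M' →ₗ[R] ((reductionFunctor φ.toRingHom).obj P) →ₗ[R] BalTensor R B M P :=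
    LinearMap.mk₂ R (fun m' x => g (e.symm m') x)
      (fun m₁ m₂ x => by
        obtain ⟨x, rfl⟩ := Reduction.mk_surjective _ x
        simp only [hg, map_add, LinearMap.add_apply])
      (fun r m x => by
        obtain ⟨x, rfl⟩ := Reduction.mk_surjective _ x
        simp only [hg, map_smul, LinearMap.smul_apply])
      (fun m x y => map_add (g (e.symm m)) x y)
      (fun r m x => by
        obtain ⟨x, rfl⟩ := Reduction.mk_surjective _ x
        have : (r • (show ((reductionFunctor φ.toRingHom).obj P) from Reduction.mk _ x)) =
            Reduction.mk φ.toRingHom (algebraMap R B r • x) := by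
          rw [← Reduction.smul_mk]
          exact congrArg (· • Reduction.mk φ.toRingHom x) (φ.commutes r).symm
        rw [this, hg, hg]
        exact map_smul (q _) r x)
  have hG (m : M) (x : P) : G (e m) (Reduction.mk φ.toRingHom x) = q m x :=
    congrArg (fun k => g k (Reduction.mk φ.toRingHom x)) (e.symm_apply_apply m)
  ModuleCat.ofHom (Submodule.liftQ _ (TensorProduct.lift G) (by
    refine Submodule.span_le.2 ?_
    rintro _ ⟨m, b, x, rfl⟩
    obtain ⟨b, rfl⟩ := RingHomSurjective.is_surjective (σ := φ.toRingHom) b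
    obtain ⟨x, rfl⟩ := Reduction.mk_surjective _ x
    obtain ⟨m, rfl⟩ := e.surjective m
    have h1 : op (φ.toRingHom b) • e m = e (op b • m) := (hμ b m).symm
    have h2 : G (e (op b • m)) (Reduction.mk φ.toRingHom x) -
        G (e m) (φ.toRingHom b • Reduction.mk φ.toRingHom x) = 0 := by
      rw [Reduction.smul_mk]
      exact sub_eq_zero.2 ((hG _ x).trans ((hq b m x).symm.trans (hG m (b • x)).symm))
    rw [← h1] at h2
    exact (map_sub (TensorProduct.lift G) _ _).trans h2))

/-- The canonical map `M ⊗_B P → M' ⊗_{B'} P / (ker φ) P` is an isomorphism, for every `B`-module `P`,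
if `M'` is `M` as a module over `B'`. -/
theorem isIso_tensor_toReduction (hinj : Function.Injective μ) (hsurj : Function.Surjective μ)
    (P : ModuleCat.{w} B) :
    IsIso ((tensorFunctor R B M).map (toReduction φ.toRingHom P) ≫
      changeOfRings φ μ hμ ((reductionFunctor φ.toRingHom).obj P)) := by
  refine ⟨tensorReductionInv φ μ hμ hinj hsurj P, ?_, ?_⟩
  · ext : 1
    refine balTensor_hom_ext fun m x => ?_
    exact congrArg (fun m => (Submodule.Quotient.mk (m ⊗ₜ x) : BalTensor R B M P))
      ((LinearEquiv.ofBijective μ ⟨hinj, hsurj⟩).symm_apply_apply m)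
  · ext : 1
    refine balTensor_hom_ext fun m x => ?_
    obtain ⟨x, rfl⟩ := Reduction.mk_surjective _ x
    exact congrArg (fun m => (Submodule.Quotient.mk (m ⊗ₜ (Reduction.mk _ x)) :
        BalTensor R B' M' ((reductionFunctor φ.toRingHom).obj P)))
      ((LinearEquiv.ofBijective μ ⟨hinj, hsurj⟩).apply_symm_apply m)

variable {N : ModuleCat.{max uB w} B} {N' : ModuleCat.{max uB w} B'}

/-- If some projective resolution of `N` over `B` stays exact modulo `ker φ`, then the change of
rings `Tor^B(M, N) → Tor^{B'}(M, N)` is an isomorphism, since it is induced by an isomorphism of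
complexes. -/
theorem exists_iso_isTorMap (hinj : Function.Injective μ) (hsurj : Function.Surjective μ)
    (ν : N ⟶ (ModuleCat.restrictScalars φ.toRingHom).obj N') (hν : Function.Bijective ν.hom)
    (P : ProjectiveResolution N)
    (h₀ : ExactMod (RingHom.ker φ.toRingHom) (P.complex.d 1 0).hom (P.π.f 0).hom)
    (h : ∀ n, ExactMod (RingHom.ker φ.toRingHom) (P.complex.d (n + 2) (n + 1)).hom
      (P.complex.d (n + 1) n).hom) (n : ℕ) :
    ∃ e : torObj.{uR, uB, uM, w} R B M N n ≅ torObj.{uR, uB, uM, w} R B' M' N' n,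
      IsTorMap φ μ hμ ν n e.hom := by
  let Q := reductionResolution φ.toRingHom P ν hν h₀ h
  let f : P.complex ⟶
      ((ModuleCat.restrictScalars φ.toRingHom).mapHomologicalComplex _).obj Q.complex :=
    { f := fun i => toReduction φ.toRingHom (P.complex.X i)
      comm' := fun i j _ => by
        ext x
        rfl }
  let F := ((tensorFunctor R B M).mapHomologicalComplex _).map f ≫
    changeOfRingsComplex φ μ hμ Q.complex
  have hF (i : ℕ) : IsIso (F.f i) :=
    isIso_tensor_toReduction φ μ hμ hinj hsurj (P.complex.X i)
  have : IsIso F := HomologicalComplex.Hom.isIso_of_components F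
  let e : ((tensorFunctor R B M).leftDerived n).obj N ≅
      ((tensorFunctor R B' M').leftDerived n).obj N' :=
    P.isoLeftDerivedObj (tensorFunctor R B M) n ≪≫
      (HomologicalComplex.homologyFunctor _ _ n).mapIso (asIso F) ≪≫
        (Q.isoLeftDerivedObj (tensorFunctor R B' M') n).symm
  have he : e.hom ≫ (Q.isoLeftDerivedObj (tensorFunctor R B' M') n).hom =
      (P.isoLeftDerivedObj (tensorFunctor R B M) n).hom ≫
        HomologicalComplex.homologyMap F n :=
    trans_trans_symm_hom_comp _ _ _
  refine ⟨e, isTorMap_of_resolutions φ μ hμ P Q f ?_ he⟩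
  ext x
  rfl

end

end TorMaps

/-! ### Exactness modulo the ideals of a cellular algebra -/

section ExactResolution

universe v

variable {B : Type uB} [Ring B] {N : ModuleCat.{max uB v} B} (P : ProjectiveResolution N)

/-- The augmented complex of a projective resolution is exact modulo `J`, except possibly for the
surjectivity of the augmentation, which is automatic. -/
def ExactModResolution (J : Ideal B) : Prop :=
  ExactMod J (P.complex.d 1 0).hom (P.π.f 0).hom ∧
    ∀ n, ExactMod J (P.complex.d (n + 2) (n + 1)).hom (P.complex.d (n + 1) n).hom

variable {P}

theorem exactMod_of_exact {J : Ideal B} {S : ShortComplex (ModuleCat.{v} B)} (hS : S.Exact)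
    (hJ : ∀ j ∈ J, ∀ x : S.X₃, j • x = 0) : ExactMod J S.f.hom S.g.hom := by
  intro x hx
  have h0 : S.g.hom x = 0 := by
    refine Submodule.smul_induction_on (p := fun y => y = 0) hx (fun b hb y _ => hJ b hb y) ?_
    rintro _ _ rfl rfl
    exact add_zero _
  obtain ⟨y, hy⟩ := (ShortComplex.moduleCat_exact_iff S).1 hS x h0
  refine ⟨y, ?_⟩
  have : S.f.hom y = x := hy
  rw [this, sub_self]
  exact Submodule.zero_mem _

theorem exactModResolution_bot : ExactModResolution P ⊥ :=
  ⟨exactMod_of_exact P.exact₀ fun j hj x => by rw [(Submodule.mem_bot B).1 hj, zero_smul],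
    fun n => exactMod_of_exact (P.exact_succ n) fun j hj x => by
      rw [(Submodule.mem_bot B).1 hj, zero_smul]⟩

/-- A row splitting carries exactness modulo `J` of a resolution over to `J'`, provided that `J'` acts
trivially on the resolved module. This makes the rows independent in the module, so that the
argument also works in low degrees. -/
theorem RowSplitting.exactModResolution {J J' : Ideal B} [J.IsTwoSided] {ι : Type uT} [Fintype ι]
    (S : RowSplitting J J' ι) (hN : ∀ j ∈ J', ∀ x : N, j • x = 0) (h : ExactModResolution P J) :
    ExactModResolution P J' := by
  have hproj (n : ℕ) : Module.Projective B (P.complex.X n) :=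
    (IsProjective.iff_projective _).2 (P.projective n)
  refine ⟨exactMod_of_exact P.exact₀ hN, fun n => ?_⟩
  cases n with
  | zero =>
    exact S.exactMod
      (fun x => LinearMap.congr_fun (congrArg ModuleCat.Hom.hom P.complex_d_comp_π_f_zero) x)
      (S.separates_of_smul_eq_zero hN) h.1 (h.2 0)
  | succ n =>
    exact S.exactMod
      (fun x => LinearMap.congr_fun (congrArg ModuleCat.Hom.hom (P.complex.d_comp_d _ _ _)) x)
      (S.separates_of_projective _) (h.2 n) (h.2 (n + 1))

end ExactResolution

section QuotientIdeals

variable {A : Type uA} [Ring A] {I J : Ideal A} [I.IsTwoSided]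

theorem map_mk_smul_eq_zero {N : Type w} [AddCommGroup N] [Module A N]
    (hI : ∀ a ∈ I, ∀ x : N, a • x = 0) (hJ : ∀ a ∈ J, ∀ x : N, a • x = 0)
    {b : A ⧸ I} (hb : b ∈ J.map (Ideal.Quotient.mk I)) (x : LeftQuot I N hI) : b • x = 0 := by
  obtain ⟨a, ha, rfl⟩ := (Ideal.mem_map_iff_of_surjective _ Ideal.Quotient.mk_surjective).1 hb
  exact hJ a ha x

variable [J.IsTwoSided]

theorem ker_factor (R : Type uR) [CommRing R] [Algebra R A] (h : I ≤ J) :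
    RingHom.ker (Ideal.Quotient.factorₐ R h).toRingHom = J.map (Ideal.Quotient.mk I) := by
  ext b
  obtain ⟨a, rfl⟩ := Ideal.Quotient.mk_surjective b
  constructor
  · intro hb
    exact Ideal.mem_map_of_mem _ (Ideal.Quotient.eq_zero_iff_mem.1 hb)
  · intro hb
    obtain ⟨a', ha', h'⟩ :=
      (Ideal.mem_map_iff_of_surjective _ Ideal.Quotient.mk_surjective).1 hb
    rw [← h']
    exact Ideal.Quotient.eq_zero_iff_mem.2 ha'

instance ringHomSurjective_factor (R : Type uR) [CommRing R] [Algebra R A] (h : I ≤ J) :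
    RingHomSurjective (Ideal.Quotient.factorₐ R h).toRingHom :=
  ⟨Ideal.Quotient.factor_surjective h⟩

end QuotientIdeals

/-- A projective resolution over `A ⧸ I_Y` of a module on which `I_X` acts trivially stays exact
modulo `I_X / I_Y`. -/
theorem CellDatum.exactModResolution {R : Type uR} {A : Type uA} [CommRing R] [Ring A]
    [Algebra R A] {L : Type uL} [PartialOrder L] (D : CellDatum.{uR, uA, uL, uT} R A L)
    {X Y : LowerSet L} (hYX : Y ≤ X) (hfin : ((X : Set L) \ (Y : Set L)).Finite)
    (hform : ∀ l ∈ (X : Set L) \ (Y : Set L), ∀ q : D.M l,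
      ∃ v : D.W l, D.form l (D.basisW q) v = 1)
    {N : ModuleCat.{max uA w} (A ⧸ D.ideal Y)}
    (hN : ∀ b ∈ (D.ideal X).map (Ideal.Quotient.mk (D.ideal Y)), ∀ x : N, b • x = 0)
    (P : ProjectiveResolution N) :
    ExactModResolution P ((D.ideal X).map (Ideal.Quotient.mk (D.ideal Y))) := by
  suffices ∀ Z : LowerSet L,
      Relation.ReflTransGen (fun Z Z' : LowerSet L => ∃ l ∈ (X : Set L) \ (Y : Set L), l ∉ Z ∧
        (Z' : Set L) = insert l (Z : Set L)) Y Z → Z ≤ X →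
      ExactModResolution P ((D.ideal Z).map (Ideal.Quotient.mk (D.ideal Y))) from
    this X (LowerSet.reflTransGen_insert Y hYX hfin) le_rfl
  intro Z hZ
  induction hZ with
  | refl =>
    intro _
    rw [Ideal.map_quotient_self]
    exact exactModResolution_bot
  | tail _ hstep ih =>
    rename_i Z Z' _
    intro hZ'X
    obtain ⟨l, hl, hlZ, hZ'⟩ := hstep
    obtain ⟨S, hS⟩ := D.exists_rowSplitting hlZ hZ' (hform l hl)
    have hZZ' : Z ≤ Z' := fun k hk => by
      have : k ∈ (Z' : Set L) := by rw [hZ']; exact Or.inr hk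
      exact this
    exact (S.map Ideal.Quotient.mk_surjective Ideal.mk_ker (hS Y)).exactModResolution
      (fun b hb => hN b (Ideal.map_mono (D.ideal_mono hZ'X) hb)) (ih (hZZ'.trans hZ'X))

theorem mainTheorem5 {R : Type uR} {A : Type uA} [CommRing R] [Ring A] [Algebra R A]
    {L : Type uL} [PartialOrder L] (D : CellDatum.{uR, uA, uL, uT} R A L)
    (X Y : LowerSet L) (hYX : Y ≤ X) (hfin : ((X : Set L) \ (Y : Set L)).Finite)
    (hform : ∀ l ∈ (X : Set L) \ (Y : Set L), ∀ q : D.M l,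
      ∃ v : D.W l, D.form l (D.basisW q) v = 1)
    {M : Type uM} [AddCommGroup M] [Module R M] [Module Aᵐᵒᵖ M] [IsScalarTower R Aᵐᵒᵖ M]
    {N : Type max uA w} [AddCommGroup N] [Module A N]
    (hM : ∀ a ∈ D.ideal X, ∀ m : M, op a • m = 0)
    (hN : ∀ a ∈ D.ideal X, ∀ x : N, a • x = 0) (n : ℕ) :
    ∃ e : torObj.{uR, uA, uM, w} R (A ⧸ D.ideal Y)
          (RightQuot (D.ideal Y) M fun a ha => hM a (D.ideal_mono hYX ha))
          (ModuleCat.of (A ⧸ D.ideal Y)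
            (LeftQuot (D.ideal Y) N fun a ha => hN a (D.ideal_mono hYX ha))) n ≅
        torObj.{uR, uA, uM, w} R (A ⧸ D.ideal X) (RightQuot (D.ideal X) M hM)
          (ModuleCat.of (A ⧸ D.ideal X) (LeftQuot (D.ideal X) N hN)) n,
      IsTorMap (Ideal.Quotient.factorₐ R (D.ideal_mono hYX)) (RightQuot.idMap R _ hM)
        (RightQuot.idMap_smul _ hM (D.ideal_mono hYX))
        (LeftQuot.idMap R _ hN (D.ideal_mono hYX)) n e.hom := by
  let P := projectiveResolution (ModuleCat.of (A ⧸ D.ideal Y)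
    (LeftQuot (D.ideal Y) N fun a ha => hN a (D.ideal_mono hYX ha)))
  have hP := D.exactModResolution hYX hfin hform (fun b hb x => map_mk_smul_eq_zero _ hN hb x) P
  rw [← ker_factor R (D.ideal_mono hYX)] at hP
  exact exists_iso_isTorMap _ _ _ Function.injective_id Function.surjective_id _
    Function.bijective_id P hP.1 hP.2 n
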